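/- Let $X$ be a finite set of variables, each of numeric type (values in $\mathbb{Q}$) or of Boolean type (values in $\mathbb{B}=\{F,T\}$). Let $\mathit{QF}$ be the set of quantifier-free formulae over typed variables with equality, linear inequality (rational coefficients) and uninterpreted function symbols (with typed arguments and result). For first-order formulae in this language, $\varphi\Rightarrow\psi$ means that under every interpretation of the function symbols, every valuation that satisfies $\varphi$ satisfies $\psi$. Program expressions are $\mathsf{Exp} ::= n \mid x \mid \mathsf{Exp}+\mathsf{Exp} \mid \mathsf{Exp}-\mathsf{Exp}$ and $\mathsf{BExp} ::= F \mid x \mid \neg\mathsf{BExp} \mid \mathsf{BExp}\wedge\mathsf{BExp} \mid \mathsf{Exp}<\mathsf{Exp} \mid \mathsf{Exp}=\mathsf{Exp}$, where $n$ is a natural number; statements are $\mathsf{nop}$, $S;S'$, $x:=e$, $x:=\mathsf{nondet}$ (any value of the type of $x$), and $\mathsf{if}\ p\ \mathsf{then}\ S\ \mathsf{else}\ S'$. With copies $X^{\langle k\rangle}=\{x^{\langle k\rangle}:x\in X\}$, and writing $\varphi^{\langle k\rangle}$ for a formula $\varphi$ over $X$ with each $x$ replaced by $x^{\langle k\rangle}$,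 the transition formula $[\![S]\!]$ over $X^{\langle0\rangle}\cup X^{\langle1\rangle}$ is $$[\![\mathsf{nop}]\!]=\bigwedge_{x\in X}x^{\langle1\rangle}=x^{\langle0\rangle},\qquad [\![x:=\mathsf{nondet}]\!]=\bigwedge_{y\in X\setminus\{x\}}y^{\langle1\rangle}=y^{\langle0\rangle},$$ $$[\![x:=e]\!]=\Big(x^{\langle1\rangle}=e^{\langle0\rangle}\wedge\bigwedge_{y\in X\setminus\{x\}}y^{\langle1\rangle}=y^{\langle0\rangle}\Big),\qquad [\![S_0;S_1]\!]=\exists X.\,[\![S_0]\!][X^{\langle1\rangle}\mapsto X]\wedge[\![S_1]\!][X^{\langle0\rangle}\mapsto X],$$ $$[\![\mathsf{if}\ p\ \mathsf{then}\ S_0\ \mathsf{else}\ S_1]\!]=(p^{\langle0\rangle}\wedge[\![S_0]\!])\vee(\neg p^{\langle0\rangle}\wedge[\![S_1]\!]).$$ The precondition $\mathit{Pre}(\theta:S)$ is given by $\mathit{Pre}(\theta:\mathsf{nop})=\theta$, $\mathit{Pre}(\theta:x:=\mathsf{nondet})=\forall x.\theta$, $\mathit{Pre}(\theta:x:=e)=\theta[x\mapsto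 e]$, $\mathit{Pre}(\theta:S_0;S_1)=\mathit{Pre}(\mathit{Pre}(\theta:S_1):S_0)$ and $\mathit{Pre}(\theta:\mathsf{if}\ p\ \mathsf{then}\ S_0\ \mathsf{else}\ S_1)=(p\Rightarrow\mathit{Pre}(\theta:S_0))\wedge(\neg p\Rightarrow\mathit{Pre}(\theta:S_1))$, with capture-avoiding substitution. Consider an annotated loop $\{\delta\}\ \mathsf{while}\ \kappa\ \mathsf{do}\ S_1;\dots;S_m\ \mathsf{done}\ \{\epsilon\}$ with $\delta,\kappa,\epsilon\in\mathsf{BExp}$. A loop invariant is a $\iota\in\mathit{QF}$ over $X$ with $\delta\Rightarrow\iota$, $\iota\wedge\neg\kappa\Rightarrow\epsilon$ and $\iota\wedge\kappa\Rightarrow\mathit{Pre}(\iota:S_1;\dots;S_m)$. An under-approximation to loop invariants is a $\underline\iota\in\mathit{QF}$ over $X$ with $\underline\iota\Rightarrow\iota$ for some loop invariant $\iota$. For $\varphi,\psi\in\mathit{QF}$ over $X$ let $$\Xi(\varphi,S_1,\dots,S_m,\psi)=\big[\varphi^{\langle0\rangle},[\![S_1]\!]^{\langle0\rangle},[\![S_2]\!]^{\langle1\rangle},\dots,[\![S_m]\!]^{\langle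 m-1\rangle},\neg\psi^{\langle m\rangle}\big],$$ where $[\![S]\!]^{\langle k\rangle}$ is $[\![S]\!]$ with $X^{\langle0\rangle},X^{\langle1\rangle}$ renamed to $X^{\langle k\rangle},X^{\langle k+1\rangle}$. An inductive interpolant of a sequence $[\theta_1,\dots,\theta_n]$ is a sequence $[\lambda_0,\dots,\lambda_n]$ of quantifier-free formulae such that 1. $\lambda_0=T$ and $\lambda_n=F$; 2. $\lambda_{i-1}\wedge\theta_i\Rightarrow\lambda_i$ for $1\le i\le n$; 3. for $1\le i<n$, every variable of $\lambda_i$ occurs free in both $\theta_i$ and $\theta_{i+1}$, and every function symbol of $\lambda_i$ occurs both in some $\theta_j$ with $j\le i$ and in some $\theta_j$ with $j>i$. **Theorem.** Let $\underline\iota$ be an under-approximation to loop invariants of the annotated loop. For every $\theta\in\mathit{QF}$ over $X$ with $\underline\iota\wedge\kappa\Rightarrow\mathit{Pre}(\theta:S_1;\dots;S_m)$, the sequence $\Xi(\underline\iota\wedge\kappa,S_1,\dots,S_m,\theta)$ has an inductive interpolant. -/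

import Mathlib

namespace LoopInterp

/-- The two types of values: numbers and Booleans. -/
inductive Ty
  | num
  | bool
  deriving DecidableEq

instance fintypeTy : Fintype Ty := ⟨{.num, .bool}, fun s => by cases s <;> decide⟩

/-- The domain `ℚ ∪ 𝔹`, split by type. -/
abbrev Dom : Ty → Type
  | .num => ℚ
  | .bool => Bool

instance decEqDom : (s : Ty) → DecidableEq (Dom s)
  | .num => inferInstanceAs (DecidableEq ℚ)
  | .bool => inferInstanceAs (DecidableEq Bool)

/-- Terms over typed variables `V` and uninterpreted function symbols `Fn`, where `Fn ds s` is the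
set of function symbols with argument types `ds` and result type `s`.  The terms of type `num` are
the linear terms with rational coefficients; the terms of type `bool` are the quantifier-free
formulae. -/
inductive Tm (Fn : List Ty → Ty → Type) (V : Ty → Type) : Ty → Type
  | var {s : Ty} (x : V s) : Tm Fn V s
  | app {ds : List Ty} {s : Ty} (f : Fn ds s)
      (args : (i : Fin ds.length) → Tm Fn V (ds.get i)) : Tm Fn V s
  | const (q : ℚ) : Tm Fn V .num
  | add (a b : Tm Fn V .num) : Tm Fn V .num
  | smul (q : ℚ) (a : Tm Fn V .num) : Tm Fn V .num
  | tt : Tm Fn V .bool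
  | ff : Tm Fn V .bool
  | eq {s : Ty} (a b : Tm Fn V s) : Tm Fn V .bool
  | lt (a b : Tm Fn V .num) : Tm Fn V .bool
  | not (p : Tm Fn V .bool) : Tm Fn V .bool
  | and (p q : Tm Fn V .bool) : Tm Fn V .bool
  | or (p q : Tm Fn V .bool) : Tm Fn V .bool

/-- Quantifier-free formulae with equality, linear inequality and uninterpreted functions. -/
abbrev QF (Fn : List Ty → Ty → Type) (V : Ty → Type) : Type := Tm Fn V .bool

/-- A (type-respecting) valuation over `V`. -/
abbrev Val (V : Ty → Type) : Type := (s : Ty) → V s → Dom s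

/-- An interpretation of the function symbols. -/
abbrev Interp (Fn : List Ty → Ty → Type) : Type :=
  (ds : List Ty) → (s : Ty) → Fn ds s → ((i : Fin ds.length) → Dom (ds.get i)) → Dom s

/-- The set of all variables of both types. -/
abbrev AllVar (V : Ty → Type) : Type := (s : Ty) × V s

/-- The set of all function symbols of all types. -/
abbrev AllFn (Fn : List Ty → Ty → Type) : Type := (ds : List Ty) × (s : Ty) × Fn ds s

namespace Tm

/-- Evaluation of a term. -/
def eval {Fn : List Ty → Ty → Type} {V : Ty → Type} (I : Interp Fn) (ν : Val V) :
    {s : Ty} → Tm Fn V s → Dom s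
  | _, .var x => ν _ x
  | _, .app f args => I _ _ f (fun i => (args i).eval I ν)
  | _, .const q => q
  | _, .add a b => ((a.eval I ν + b.eval I ν : ℚ))
  | _, .smul q a => ((q * a.eval I ν : ℚ))
  | _, .tt => true
  | _, .ff => false
  | _, .eq a b => decide (a.eval I ν = b.eval I ν)
  | _, .lt a b => decide ((a.eval I ν : ℚ) < (b.eval I ν : ℚ))
  | _, .not p => !(p.eval I ν)
  | _, .and p q => p.eval I ν && q.eval I ν
  | _, .or p q => p.eval I ν || q.eval I ν

/-- Simultaneous substitution of terms for variables. -/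
def subst {Fn : List Ty → Ty → Type} {V W : Ty → Type} (σ : (s : Ty) → V s → Tm Fn W s) :
    {s : Ty} → Tm Fn V s → Tm Fn W s
  | _, .var x => σ _ x
  | _, .app f args => .app f (fun i => (args i).subst σ)
  | _, .const q => .const q
  | _, .add a b => .add (a.subst σ) (b.subst σ)
  | _, .smul q a => .smul q (a.subst σ)
  | _, .tt => .tt
  | _, .ff => .ff
  | _, .eq a b => .eq (a.subst σ) (b.subst σ)
  | _, .lt a b => .lt (a.subst σ) (b.subst σ)
  | _, .not p => .not (p.subst σ)
  | _, .and p q => .and (p.subst σ) (q.subst σ)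
  | _, .or p q => .or (p.subst σ) (q.subst σ)

/-- Renaming of variables. -/
def rename {Fn : List Ty → Ty → Type} {V W : Ty → Type} (r : (s : Ty) → V s → W s)
    {s : Ty} (t : Tm Fn V s) : Tm Fn W s :=
  t.subst (fun s x => .var (r s x))

/-- The variables that occur in a term. -/
def vars {Fn : List Ty → Ty → Type} {V : Ty → Type} : {s : Ty} → Tm Fn V s → Set (AllVar V)
  | s, .var x => {⟨s, x⟩}
  | _, .app _ args => ⋃ i, (args i).vars
  | _, .const _ => ∅
  | _, .add a b => a.vars ∪ b.vars
  | _, .smul _ a => a.vars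
  | _, .tt => ∅
  | _, .ff => ∅
  | _, .eq a b => a.vars ∪ b.vars
  | _, .lt a b => a.vars ∪ b.vars
  | _, .not p => p.vars
  | _, .and p q => p.vars ∪ q.vars
  | _, .or p q => p.vars ∪ q.vars

/-- The uninterpreted function symbols that occur in a term. -/
def fns {Fn : List Ty → Ty → Type} {V : Ty → Type} : {s : Ty} → Tm Fn V s → Set (AllFn Fn)
  | _, .var _ => ∅
  | s, .app (ds := ds) f args => {⟨ds, s, f⟩} ∪ ⋃ i, (args i).fns
  | _, .const _ => ∅
  | _, .add a b => a.fns ∪ b.fns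
  | _, .smul _ a => a.fns
  | _, .tt => ∅
  | _, .ff => ∅
  | _, .eq a b => a.fns ∪ b.fns
  | _, .lt a b => a.fns ∪ b.fns
  | _, .not p => p.fns
  | _, .and p q => p.fns ∪ q.fns
  | _, .or p q => p.fns ∪ q.fns

end Tm

/-- The variables `V` together with the (to be bound) variables `Y`. -/
abbrev Ext (V Y : Ty → Type) : Ty → Type := fun s => V s ⊕ Y s

/-- The family with exactly one variable, of type `s`. -/
abbrev One (s : Ty) : Ty → Type := fun t => PLift (t = s)

/-- First-order formulae with free variables in `V`.  A quantifier binds a finite block `Y` of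
variables; the body is a formula over `V` and `Y`, so that there is no variable capture. -/
inductive FO (Fn : List Ty → Ty → Type) : (Ty → Type) → Type 1
  | qf {V : Ty → Type} (p : QF Fn V) : FO Fn V
  | neg {V : Ty → Type} (φ : FO Fn V) : FO Fn V
  | and {V : Ty → Type} (φ ψ : FO Fn V) : FO Fn V
  | or {V : Ty → Type} (φ ψ : FO Fn V) : FO Fn V
  | ex {V : Ty → Type} (Y : Ty → Type) (hY : ∀ s, Finite (Y s)) (φ : FO Fn (Ext V Y)) : FO Fn V
  | all {V : Ty → Type} (Y : Ty → Type) (hY : ∀ s, Finite (Y s)) (φ : FO Fn (Ext V Y)) : FO Fn V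

namespace FO

/-- Truth of a first-order formula. -/
def Holds {Fn : List Ty → Ty → Type} (I : Interp Fn) :
    {V : Ty → Type} → FO Fn V → Val V → Prop
  | _, .qf p, ν => p.eval I ν = true
  | _, .neg φ, ν => ¬ φ.Holds I ν
  | _, .and φ ψ, ν => φ.Holds I ν ∧ ψ.Holds I ν
  | _, .or φ ψ, ν => φ.Holds I ν ∨ ψ.Holds I ν
  | _, .ex Y _ φ, ν => ∃ μ : Val Y, φ.Holds I (fun s => Sum.elim (ν s) (μ s))
  | _, .all Y _ φ, ν => ∀ μ : Val Y, φ.Holds I (fun s => Sum.elim (ν s) (μ s))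

/-- Capture-avoiding simultaneous substitution of terms for the free variables. -/
def subst {Fn : List Ty → Ty → Type} :
    {V W : Ty → Type} → ((s : Ty) → V s → Tm Fn W s) → FO Fn V → FO Fn W
  | _, _, σ, .qf p => .qf (p.subst σ)
  | _, _, σ, .neg φ => .neg (φ.subst σ)
  | _, _, σ, .and φ ψ => .and (φ.subst σ) (ψ.subst σ)
  | _, _, σ, .or φ ψ => .or (φ.subst σ) (ψ.subst σ)
  | _, _, σ, .ex Y hY φ => .ex Y hY (φ.subst (fun s =>
      Sum.elim (fun x => (σ s x).rename (fun _ => Sum.inl)) (fun y => .var (Sum.inr y))))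
  | _, _, σ, .all Y hY φ => .all Y hY (φ.subst (fun s =>
      Sum.elim (fun x => (σ s x).rename (fun _ => Sum.inl)) (fun y => .var (Sum.inr y))))

/-- Capture-avoiding renaming of the free variables. -/
def rename {Fn : List Ty → Ty → Type} {V W : Ty → Type} (r : (s : Ty) → V s → W s)
    (φ : FO Fn V) : FO Fn W :=
  φ.subst (fun s x => .var (r s x))

/-- The variables that occur free in a formula. -/
def vars {Fn : List Ty → Ty → Type} : {V : Ty → Type} → FO Fn V → Set (AllVar V)
  | _, .qf p => p.vars
  | _, .neg φ => φ.vars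
  | _, .and φ ψ => φ.vars ∪ ψ.vars
  | _, .or φ ψ => φ.vars ∪ ψ.vars
  | _, .ex _ _ φ => {v | ⟨v.1, Sum.inl v.2⟩ ∈ φ.vars}
  | _, .all _ _ φ => {v | ⟨v.1, Sum.inl v.2⟩ ∈ φ.vars}

/-- The uninterpreted function symbols that occur in a formula. -/
def fns {Fn : List Ty → Ty → Type} : {V : Ty → Type} → FO Fn V → Set (AllFn Fn)
  | _, .qf p => p.fns
  | _, .neg φ => φ.fns
  | _, .and φ ψ => φ.fns ∪ ψ.fns
  | _, .or φ ψ => φ.fns ∪ ψ.fns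
  | _, .ex _ _ φ => φ.fns
  | _, .all _ _ φ => φ.fns

/-- Implication. -/
def imp {Fn : List Ty → Ty → Type} {V : Ty → Type} (φ ψ : FO Fn V) : FO Fn V :=
  .or (.neg φ) ψ

/-- The conjunction of a finite list of formulae. -/
def conj {Fn : List Ty → Ty → Type} {V : Ty → Type} : List (FO Fn V) → FO Fn V
  | [] => .qf .tt
  | φ :: L => .and φ (conj L)

/-- Entailment `φ ⇒ ψ`: under every interpretation of the function symbols, every valuation that
satisfies `φ` satisfies `ψ`. -/
def Entails {Fn : List Ty → Ty → Type} {V : Ty → Type} (φ ψ : FO Fn V) : Prop :=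
  ∀ (I : Interp Fn) (ν : Val V), φ.Holds I ν → ψ.Holds I ν

end FO

/-- Numeric program expressions. -/
inductive Exp (X : Ty → Type) : Type
  | lit (n : ℕ) : Exp X
  | var (x : X .num) : Exp X
  | add (a b : Exp X) : Exp X
  | sub (a b : Exp X) : Exp X

/-- Boolean program expressions. -/
inductive BExp (X : Ty → Type) : Type
  | ff : BExp X
  | var (x : X .bool) : BExp X
  | not (p : BExp X) : BExp X
  | and (p q : BExp X) : BExp X
  | lt (a b : Exp X) : BExp X
  | eq (a b : Exp X) : BExp X

/-- Statements. -/
inductive Stmt (X : Ty → Type) : Type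
  | nop : Stmt X
  | seq (S T : Stmt X) : Stmt X
  | assign (x : X .num) (e : Exp X) : Stmt X
  | nondet (s : Ty) (x : X s) : Stmt X
  | ite (p : BExp X) (S T : Stmt X) : Stmt X

/-- A numeric expression as a linear term. -/
def Exp.toTm (Fn : List Ty → Ty → Type) {X : Ty → Type} : Exp X → Tm Fn X .num
  | .lit n => .const (n : ℚ)
  | .var x => .var x
  | .add a b => .add (a.toTm Fn) (b.toTm Fn)
  | .sub a b => .add (a.toTm Fn) (.smul (-1) (b.toTm Fn))

/-- A Boolean expression as a quantifier-free formula. -/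
def BExp.toQF (Fn : List Ty → Ty → Type) {X : Ty → Type} : BExp X → QF Fn X
  | .ff => .ff
  | .var x => .var x
  | .not p => .not (p.toQF Fn)
  | .and p q => .and (p.toQF Fn) (q.toQF Fn)
  | .lt a b => .lt (a.toTm Fn) (b.toTm Fn)
  | .eq a b => .eq (a.toTm Fn) (b.toTm Fn)

/-- The sequential composition `S₁; S₂; …; Sₘ`. -/
def Stmt.seqs {X : Ty → Type} : List (Stmt X) → Stmt X
  | [] => .nop
  | [S] => S
  | S :: T :: L => .seq S (Stmt.seqs (T :: L))

/-- The superscripted variables: `(x, k)` stands for `x⟨k⟩`. -/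
abbrev Sup (K : Type) (X : Ty → Type) : Ty → Type := fun s => X s × K

/-- Frame condition: `y⟨1⟩ = y⟨0⟩` for every variable `y` in the finite set `A`. -/
noncomputable def frame (Fn : List Ty → Ty → Type) {X : Ty → Type} (A : Finset (AllVar X)) :
    FO Fn (Sup (Fin 2) X) :=
  FO.conj (A.toList.map fun y => .qf (.eq (.var (y.2, 1)) (.var (y.2, 0))))

open Classical in
/-- The transition formula of a statement, over `X⟨0⟩ ∪ X⟨1⟩`. -/
noncomputable def Stmt.trans (Fn : List Ty → Ty → Type) {X : Ty → Type} [∀ s, Fintype (X s)] :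
    Stmt X → FO Fn (Sup (Fin 2) X)
  | .nop => frame Fn Finset.univ
  | .nondet s x => frame Fn (Finset.univ.erase ⟨s, x⟩)
  | .assign x e =>
      .and (.qf (.eq (.var (x, 1)) ((e.toTm Fn).rename (fun _ y => (y, 0)))))
        (frame Fn (Finset.univ.erase ⟨.num, x⟩))
  | .seq S T =>
      .ex X (fun _ => inferInstance) (.and
        ((S.trans Fn).rename (fun _ v => if v.2 = 1 then Sum.inr v.1 else Sum.inl v))
        ((T.trans Fn).rename (fun _ v => if v.2 = 0 then Sum.inr v.1 else Sum.inl v)))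
  | .ite p S T =>
      .or (.and (.qf ((p.toQF Fn).rename (fun _ y => (y, 0)))) (S.trans Fn))
        (.and (.qf (.not ((p.toQF Fn).rename (fun _ y => (y, 0))))) (T.trans Fn))

open Classical in
/-- The precondition `Pre(θ : S)`. -/
noncomputable def Stmt.pre {Fn : List Ty → Ty → Type} {X : Ty → Type} :
    Stmt X → FO Fn X → FO Fn X
  | .nop, θ => θ
  | .nondet s x, θ => .all (One s) (fun _ => inferInstance) (θ.rename (fun t y =>
      if h : (⟨t, y⟩ : AllVar X) = ⟨s, x⟩ then Sum.inr ⟨congrArg Sigma.fst h⟩ else Sum.inl y))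
  | .assign x e, θ => θ.subst (fun t => match t with
      | .num => fun y => if y = x then e.toTm Fn else .var y
      | .bool => fun y => .var y)
  | .seq S T, θ => S.pre (T.pre θ)
  | .ite p S T, θ =>
      .and (FO.imp (.qf (p.toQF Fn)) (S.pre θ)) (FO.imp (.neg (.qf (p.toQF Fn))) (T.pre θ))

/-- An annotated loop `{ δ } while κ do S₁; …; Sₘ done { ε }`. -/
structure Loop (X : Ty → Type) where
  /-- the precondition `δ` -/
  precond : BExp X
  /-- the loop guard `κ` -/
  guard : BExp X
  /-- the loop body `S₁, …, Sₘ` -/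
  body : List (Stmt X)
  /-- the postcondition `ε` -/
  postcond : BExp X

/-- `ι` is a loop invariant of the annotated loop. -/
def Loop.IsInvariant {Fn : List Ty → Ty → Type} {X : Ty → Type} (L : Loop X) (ι : QF Fn X) :
    Prop :=
  FO.Entails (.qf (L.precond.toQF Fn)) (.qf ι) ∧
  FO.Entails (.qf (.and ι (.not (L.guard.toQF Fn)))) (.qf (L.postcond.toQF Fn)) ∧
  FO.Entails (.qf (.and ι (L.guard.toQF Fn))) ((Stmt.seqs L.body).pre (.qf ι))

/-- `ι` is an under-approximation to loop invariants: it is stronger than some loop invariant. -/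
def Loop.IsUnderApprox {Fn : List Ty → Ty → Type} {X : Ty → Type} (L : Loop X) (ι : QF Fn X) :
    Prop :=
  ∃ ι' : QF Fn X, L.IsInvariant ι' ∧ FO.Entails (.qf ι) (.qf ι')

/-- The sequence `Ξ(φ, S₁, …, Sₘ, ψ) = [φ⟨0⟩, ⟦S₁⟧⟨0⟩, …, ⟦Sₘ⟧⟨m-1⟩, ¬ψ⟨m⟩]`. -/
noncomputable def Xi {Fn : List Ty → Ty → Type} {X : Ty → Type} [∀ s, Fintype (X s)]
    (φ : QF Fn X) (Ss : List (Stmt X)) (ψ : QF Fn X) : List (FO Fn (Sup ℕ X)) :=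
  [.qf (φ.rename (fun _ x => (x, 0)))] ++
  Ss.mapIdx (fun k S => (S.trans Fn).rename (fun _ v => (v.1, k + v.2.val))) ++
  [.qf (.not (ψ.rename (fun _ x => (x, Ss.length))))]

/-- `Λ = [λ₀, …, λₙ]` is an inductive interpolant of `Θ = [θ₁, …, θₙ]` (the list entry `Θ[i]`
is `θᵢ₊₁`).  A variable of `λᵢ` occurs in both `θᵢ` and `θᵢ₊₁`; a function symbol of `λᵢ` occurs
both in one of `θ₁, …, θᵢ` and in one of `θᵢ₊₁, …, θₙ`. -/
structure IsInductiveInterpolant {Fn : List Ty → Ty → Type} {V : Ty → Type}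
    (Θ : List (FO Fn V)) (Λ : Fin (Θ.length + 1) → QF Fn V) : Prop where
  first : Λ 0 = .tt
  last : Λ (Fin.last Θ.length) = .ff
  step : ∀ i : Fin Θ.length, FO.Entails (.and (.qf (Λ i.castSucc)) (Θ.get i)) (.qf (Λ i.succ))
  vars_subset : ∀ (i : ℕ) (hi : i + 1 < Θ.length),
    (Λ ⟨i + 1, by omega⟩).vars ⊆ (Θ[i]).vars ∩ (Θ[i + 1]).vars
  fns_subset : ∀ (i : ℕ) (hi : i + 1 < Θ.length),
    (Λ ⟨i + 1, by omega⟩).fns ⊆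
      (⋃ j : Fin Θ.length, ⋃ _ : j.val ≤ i, (Θ.get j).fns) ∩
      (⋃ j : Fin Θ.length, ⋃ _ : i < j.val, (Θ.get j).fns)

end LoopInterp

/-! The sequence is jointly unsatisfiable. A common model assigns valuations to the successive
copies of `X` that form a run of the loop body, and soundness of `Pre` (`Stmt.holds_of_pre`) carries
the precondition at the start of the run to the postcondition at its end, against the last entry.
Moreover every entry is existential, and a copy of a variable lives in at most two neighbouring
entries. So an inductive interpolant arises by iterated Craig interpolation: each new formula
separates the conjunction of its predecessor and the current entry from the conjunction of all later
entries (`IsPrefixInterpolant.exists_succ`).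

The weight lies in `separable_of_disjoint`, a Craig interpolation theorem with quantifier-free
interpolants for linear rational arithmetic, Booleans and uninterpreted functions. The right side
enters only semantically: its truth in a model is secured by finitely many function values
(`FinDep`). The left side is split into finitely many cases, according to the truth values of its
Boolean subterms and the signs of the differences of its numeric subterms. Each case is a linear
system whose unknowns are the values of numeric variables and applications, with the shared
variables as parameters, together with constraints saying that a symbol takes a given value at given
arguments.

`separable_of_sys` removes equations by substitution, and turns an application into a term of the
common language once its symbol is shared and its arguments contain no unknowns. When neither is
possible, only strict inequalities restrict the unknowns, so a solution can be perturbed until each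
remaining shared application has an argument outside the finite set that the right side inspects.
There the function can be redefined freely. Hence the Fourier–Motzkin elimination of the unknowns,
with the conditions on the parameters, is the interpolant: a model of it and of the right side could
be changed into a model of both sides. -/

namespace LoopInterp

/-! ### Substitution, subterms and finite support of terms. -/

section Terms

variable {Fn : List Ty → Ty → Type} {V W : Ty → Type}

theorem Tm.eval_subst (I : Interp Fn) (ν : Val W) (σ : (s : Ty) → V s → Tm Fn W s) :
    ∀ {s : Ty} (t : Tm Fn V s),
      (t.subst σ).eval I ν = t.eval I (fun s x => (σ s x).eval I ν) := by
  intro s t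
  induction t <;> simp_all [Tm.subst, Tm.eval]

theorem Tm.eval_rename (I : Interp Fn) (ν : Val W) (r : (s : Ty) → V s → W s) {s : Ty}
    (t : Tm Fn V s) : (t.rename r).eval I ν = t.eval I (fun s x => ν s (r s x)) :=
  Tm.eval_subst I ν _ t

theorem Tm.mem_vars_subst (σ : (s : Ty) → V s → Tm Fn W s) {s : Ty} (t : Tm Fn V s)
    {w : AllVar W} (h : w ∈ (t.subst σ).vars) : ∃ v ∈ t.vars, w ∈ (σ v.1 v.2).vars := by
  induction t <;> simp_all [Tm.subst, Tm.vars] <;> grind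

theorem Tm.mem_vars_rename (r : (s : Ty) → V s → W s) {s : Ty} (t : Tm Fn V s)
    {w : AllVar W} (h : w ∈ (t.rename r).vars) : ∃ v ∈ t.vars, w = ⟨v.1, r v.1 v.2⟩ := by
  obtain ⟨v, hv, h⟩ := Tm.mem_vars_subst _ t h
  exact ⟨v, hv, h⟩

theorem Tm.fns_rename (r : (s : Ty) → V s → W s) {s : Ty} (t : Tm Fn V s) :
    (t.rename r).fns = t.fns := by
  unfold Tm.rename
  induction t <;> simp_all [Tm.subst, Tm.fns]

/-- The interpretations `I` and `J` agree for the symbols in `F` at the tuples of elements of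
`E`. -/
def AgreeOn (F : Set (AllFn Fn)) (E : Set ((s : Ty) × Dom s)) (I J : Interp Fn) : Prop :=
  ∀ (ds : List Ty) (s : Ty) (f : Fn ds s), ⟨ds, s, f⟩ ∈ F →
    ∀ d : (i : Fin ds.length) → Dom (ds.get i), (∀ i, ⟨ds.get i, d i⟩ ∈ E) → I ds s f d = J ds s f d

theorem AgreeOn.mono {F F' : Set (AllFn Fn)} {E E' : Set ((s : Ty) × Dom s)} {I J : Interp Fn}
    (h : AgreeOn F E I J) (hF : F' ⊆ F) (hE : E' ⊆ E) : AgreeOn F' E' I J :=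
  fun ds s f hf d hd => h ds s f (hF hf) d fun i => hE (hd i)

/-- The valuations `ν` and `ν'` agree on the variables in `U`. -/
def AgreeVar (U : Set (AllVar V)) (ν ν' : Val V) : Prop :=
  ∀ v ∈ U, ν v.1 v.2 = ν' v.1 v.2

theorem AgreeVar.mono {U U' : Set (AllVar V)} {ν ν' : Val V} (h : AgreeVar U ν ν')
    (hU : U' ⊆ U) : AgreeVar U' ν ν' :=
  fun v hv => h v (hU hv)

/-- The value of a term depends only on the values of its variables and on the interpretation of
its function symbols at finitely many arguments. -/
theorem Tm.exists_finite_support (I : Interp Fn) (ν : Val V) {s : Ty} (t : Tm Fn V s) :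
    ∃ E : Set ((s : Ty) × Dom s), E.Finite ∧ ∀ (J : Interp Fn) (ν' : Val V),
      AgreeOn t.fns E I J → AgreeVar t.vars ν ν' → t.eval J ν' = t.eval I ν := by
  induction t with
  | var x => exact ⟨∅, Set.finite_empty, fun J ν' _ h => (h ⟨_, x⟩ rfl).symm⟩
  | @app ds s f args ih =>
    choose E hE h using ih
    -- Besides the points needed by the arguments, `f` is read at a single tuple: the values of its
    -- arguments.
    refine ⟨(⋃ i, E i) ∪ Set.range fun i => ⟨ds.get i, (args i).eval I ν⟩,
      (Set.finite_iUnion hE).union (Set.finite_range _), fun J ν' hJ hν => ?_⟩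
    have key : ∀ i, (args i).eval J ν' = (args i).eval I ν := fun i =>
      h i J ν' (hJ.mono (fun _ hx => Or.inr (Set.mem_iUnion_of_mem i hx))
        (fun _ hx => Or.inl (Set.mem_iUnion_of_mem i hx)))
        (hν.mono fun _ hx => Set.mem_iUnion_of_mem i hx)
    simp only [Tm.eval, key]
    exact (hJ ds s f (Or.inl rfl) _ fun i => Or.inr ⟨i, rfl⟩).symm
  | const q => exact ⟨∅, Set.finite_empty, fun _ _ _ _ => rfl⟩
  | tt => exact ⟨∅, Set.finite_empty, fun _ _ _ _ => rfl⟩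
  | ff => exact ⟨∅, Set.finite_empty, fun _ _ _ _ => rfl⟩
  | smul q a ih =>
    obtain ⟨E, hE, h⟩ := ih
    exact ⟨E, hE, fun J ν' hJ hν => by simp only [Tm.eval, h J ν' hJ hν]⟩
  | not a ih =>
    obtain ⟨E, hE, h⟩ := ih
    exact ⟨E, hE, fun J ν' hJ hν => by simp only [Tm.eval, h J ν' hJ hν]⟩
  | add a b iha ihb | eq a b iha ihb | lt a b iha ihb | and a b iha ihb | or a b iha ihb =>
    obtain ⟨E, hE, h⟩ := iha
    obtain ⟨E', hE', h'⟩ := ihb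
    refine ⟨E ∪ E', hE.union hE', fun J ν' hJ hν => ?_⟩
    simp only [Tm.eval,
      h J ν' (hJ.mono Set.subset_union_left Set.subset_union_left)
        (hν.mono Set.subset_union_left),
      h' J ν' (hJ.mono Set.subset_union_right Set.subset_union_right)
        (hν.mono Set.subset_union_right)]

/-- The set of subterms of a term. -/
def Tm.subs : {s : Ty} → Tm Fn V s → Set ((s : Ty) × Tm Fn V s)
  | s, .var x => {⟨s, .var x⟩}
  | s, .app f args => insert ⟨s, .app f args⟩ (⋃ i, (args i).subs)
  | _, .const q => {⟨_, .const q⟩}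
  | _, .add a b => insert ⟨_, .add a b⟩ (a.subs ∪ b.subs)
  | _, .smul q a => insert ⟨_, .smul q a⟩ a.subs
  | _, .tt => {⟨_, .tt⟩}
  | _, .ff => {⟨_, .ff⟩}
  | _, .eq a b => insert ⟨_, .eq a b⟩ (a.subs ∪ b.subs)
  | _, .lt a b => insert ⟨_, .lt a b⟩ (a.subs ∪ b.subs)
  | _, .not p => insert ⟨_, .not p⟩ p.subs
  | _, .and p q => insert ⟨_, .and p q⟩ (p.subs ∪ q.subs)
  | _, .or p q => insert ⟨_, .or p q⟩ (p.subs ∪ q.subs)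

theorem Tm.finite_subs {s : Ty} (t : Tm Fn V s) : t.subs.Finite := by
  induction t with
  | app f args ih => exact (Set.finite_iUnion ih).insert _
  | var | const | tt | ff => exact Set.finite_singleton _
  | smul q a ih => exact ih.insert _
  | not a ih => exact ih.insert _
  | add a b iha ihb | eq a b iha ihb | lt a b iha ihb | and a b iha ihb | or a b iha ihb =>
    exact (iha.union ihb).insert _

theorem Tm.self_mem_subs {s : Ty} (t : Tm Fn V s) : ⟨s, t⟩ ∈ t.subs := by
  cases t <;> simp [Tm.subs]

theorem Tm.subs_subset {s : Ty} (t : Tm Fn V s) {u : (s : Ty) × Tm Fn V s} (hu : u ∈ t.subs) :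
    u.2.subs ⊆ t.subs := by
  induction t with
  | app f args ih =>
    rcases hu with rfl | hu
    · exact subset_rfl
    · obtain ⟨i, hu⟩ := Set.mem_iUnion.1 hu
      exact (ih i hu).trans fun _ hx => Or.inr (Set.mem_iUnion_of_mem i hx)
  | var | const | tt | ff => cases hu; exact subset_rfl
  | smul q a ih =>
    rcases hu with rfl | hu
    · exact subset_rfl
    · exact (ih hu).trans (Set.subset_insert _ _)
  | not a ih =>
    rcases hu with rfl | hu
    · exact subset_rfl
    · exact (ih hu).trans (Set.subset_insert _ _)
  | add a b iha ihb | eq a b iha ihb | lt a b iha ihb | and a b iha ihb | or a b iha ihb =>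
    rcases hu with rfl | hu | hu
    · exact subset_rfl
    · exact (iha hu).trans fun _ hx => Or.inr (Or.inl hx)
    · exact (ihb hu).trans fun _ hx => Or.inr (Or.inr hx)

theorem Tm.var_mem_subs_iff {s : Ty} (t : Tm Fn V s) (v : AllVar V) :
    ⟨v.1, .var v.2⟩ ∈ t.subs ↔ v ∈ t.vars := by
  obtain ⟨r, x⟩ := v
  induction t with
  | var y =>
    simp only [Tm.subs, Tm.vars, Set.mem_singleton_iff]
    constructor
    · intro h; cases h; rfl
    · intro h; cases h; rfl
  | app f args ih =>
    simp only [Tm.subs, Tm.vars, Set.mem_insert_iff, Set.mem_iUnion, ih]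
    refine ⟨fun h => h.resolve_left ?_, Or.inr⟩
    intro h; cases h
  | const | tt | ff => 
    simp only [Tm.subs, Tm.vars, Set.mem_singleton_iff, Set.mem_empty_iff_false, iff_false]
    intro h; cases h
  | smul q a ih =>
    simp only [Tm.subs, Tm.vars, Set.mem_insert_iff, ih]
    refine ⟨fun h => h.resolve_left ?_, Or.inr⟩
    intro h; cases h
  | not a ih =>
    simp only [Tm.subs, Tm.vars, Set.mem_insert_iff, ih]
    refine ⟨fun h => h.resolve_left ?_, Or.inr⟩
    intro h; cases h
  | add a b iha ihb | eq a b iha ihb | lt a b iha ihb | and a b iha ihb | or a b iha ihb =>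
    simp only [Tm.subs, Tm.vars, Set.mem_insert_iff, Set.mem_union, iha, ihb]
    refine ⟨fun h => h.resolve_left ?_, Or.inr⟩
    intro h; cases h

theorem Tm.fn_mem_fns_of_mem_subs {s : Ty} (t : Tm Fn V s) {ds : List Ty} {r : Ty} (f : Fn ds r)
    (args : (i : Fin ds.length) → Tm Fn V (ds.get i)) (h : ⟨r, .app f args⟩ ∈ t.subs) :
    ⟨ds, r, f⟩ ∈ t.fns := by
  induction t with
  | app g args' ih =>
    rcases h with h | h
    · cases h; exact Or.inl rfl
    · obtain ⟨i, h⟩ := Set.mem_iUnion.1 h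
      exact Or.inr (Set.mem_iUnion_of_mem i (ih i h))
  | var | const | tt | ff => cases h
  | smul q a ih =>
    rcases h with h | h
    · cases h
    · exact ih h
  | not a ih =>
    rcases h with h | h
    · cases h
    · exact ih h
  | add a b iha ihb | eq a b iha ihb | lt a b iha ihb | and a b iha ihb | or a b iha ihb =>
    rcases h with h | h | h
    · cases h
    · exact Or.inl (iha h)
    · exact Or.inr (ihb h)

end Terms

/-! ### Affine forms with symbolic constant part, Fourier–Motzkin elimination, and generic
solutions. -/

section Systems

variable {Fn : List Ty → Ty → Type} {V : Ty → Type}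

/-- The terms over the variables in `VS` and the function symbols in `FS`. -/
abbrev STm (VS : Set (AllVar V)) (FS : Set (AllFn Fn)) (s : Ty) : Type :=
  {t : Tm Fn V s // t.vars ⊆ VS ∧ t.fns ⊆ FS}

/-- Affine forms in the unknowns `K`, with a term over `VS` and `FS` as constant part. -/
structure Aff (K : Type) (VS : Set (AllVar V)) (FS : Set (AllFn Fn)) where
  /-- the coefficients of the unknowns -/
  coef : K →₀ ℚ
  /-- the constant part -/
  rest : STm VS FS .num

variable {K : Type} {VS : Set (AllVar V)} {FS : Set (AllFn Fn)}

namespace STm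

/-- A rational constant. -/
def const (q : ℚ) : STm VS FS .num := ⟨.const q, by simp [Tm.vars], by simp [Tm.fns]⟩

/-- The sum `a + q b`. -/
def addSMul (a : STm VS FS .num) (q : ℚ) (b : STm VS FS .num) : STm VS FS .num :=
  ⟨.add a.1 (.smul q b.1), Set.union_subset a.2.1 b.2.1, Set.union_subset a.2.2 b.2.2⟩

/-- The equation `a = b`. -/
def eq {s : Ty} (a b : STm VS FS s) : STm VS FS .bool :=
  ⟨.eq a.1 b.1, Set.union_subset a.2.1 b.2.1, Set.union_subset a.2.2 b.2.2⟩

/-- The inequality `a < b`. -/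
def lt (a b : STm VS FS .num) : STm VS FS .bool :=
  ⟨.lt a.1 b.1, Set.union_subset a.2.1 b.2.1, Set.union_subset a.2.2 b.2.2⟩

/-- Conjunction. -/
def and (a b : STm VS FS .bool) : STm VS FS .bool :=
  ⟨.and a.1 b.1, Set.union_subset a.2.1 b.2.1, Set.union_subset a.2.2 b.2.2⟩

/-- Disjunction. -/
def or (a b : STm VS FS .bool) : STm VS FS .bool :=
  ⟨.or a.1 b.1, Set.union_subset a.2.1 b.2.1, Set.union_subset a.2.2 b.2.2⟩

/-- A Boolean constant. -/
def ofBool (b : Bool) : STm VS FS .bool :=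
  ⟨bif b then .tt else .ff, by cases b <;> simp [Tm.vars], by cases b <;> simp [Tm.fns]⟩

theorem eval_ofBool (b : Bool) (I : Interp Fn) (ν : Val V) :
    (ofBool b : STm VS FS .bool).1.eval I ν = b := by
  cases b <;> rfl

theorem eval_lt (a b : STm VS FS .num) (I : Interp Fn) (ν : Val V) :
    (a.lt b).1.eval I ν = true ↔ (a.1.eval I ν : ℚ) < (b.1.eval I ν : ℚ) :=
  decide_eq_true_iff

theorem eval_eq {s : Ty} (a b : STm VS FS s) (I : Interp Fn) (ν : Val V) :
    (a.eq b).1.eval I ν = true ↔ a.1.eval I ν = b.1.eval I ν :=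
  decide_eq_true_iff

theorem eval_and (a b : STm VS FS .bool) (I : Interp Fn) (ν : Val V) :
    (a.and b).1.eval I ν = true ↔ a.1.eval I ν = true ∧ b.1.eval I ν = true :=
  Bool.and_eq_true_iff

theorem eval_or (a b : STm VS FS .bool) (I : Interp Fn) (ν : Val V) :
    (a.or b).1.eval I ν = true ↔ a.1.eval I ν = true ∨ b.1.eval I ν = true :=
  Bool.or_eq_true_iff

/-- The conjunction of a list. -/
def conj : List (STm VS FS .bool) → STm VS FS .bool
  | [] => ofBool true
  | a :: l => a.and (conj l)

theorem eval_conj (I : Interp Fn) (ν : Val V) (l : List (STm VS FS .bool)) :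
    (conj l).1.eval I ν = true ↔ ∀ a ∈ l, a.1.eval I ν = true := by
  induction l with
  | nil => simp [conj, ofBool, Tm.eval]
  | cons a l ih =>
    rw [List.forall_mem_cons, ← ih]
    exact eval_and a (conj l) I ν

end STm

namespace Aff

/-- The value of an affine form. -/
noncomputable def eval (a : Aff K VS FS) (I : Interp Fn) (ν : Val V) (x : K → ℚ) : ℚ :=
  Finsupp.linearCombination ℚ x a.coef + (a.rest.1.eval I ν : ℚ)

/-- The affine form `a + q b`. -/
noncomputable def addSMul (a : Aff K VS FS) (q : ℚ) (b : Aff K VS FS) : Aff K VS FS :=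
  ⟨a.coef + q • b.coef, a.rest.addSMul q b.rest⟩

/-- The constant affine form. -/
noncomputable def ofTm (t : STm VS FS .num) : Aff K VS FS := ⟨0, t⟩

theorem eval_addSMul (a : Aff K VS FS) (q : ℚ) (b : Aff K VS FS) (I : Interp Fn) (ν : Val V)
    (x : K → ℚ) : (a.addSMul q b).eval I ν x = a.eval I ν x + q * b.eval I ν x := by
  simp only [eval, addSMul, STm.addSMul, Tm.eval, map_add, map_smul, smul_eq_mul]
  ring

theorem eval_of_coef_eq_zero {a : Aff K VS FS} (h : a.coef = 0) (I : Interp Fn) (ν : Val V)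
    (x : K → ℚ) : a.eval I ν x = (a.rest.1.eval I ν : ℚ) := by
  simp [eval, h]

open Classical in
theorem eval_shift (a : Aff K VS FS) (I : Interp Fn) (ν : Val V) (x : K → ℚ) (k : K) (δ : ℚ) :
    a.eval I ν (x + Pi.single k δ) = a.eval I ν x + a.coef k * δ := by
  have : ∀ c : K →₀ ℚ, Finsupp.linearCombination ℚ (x + Pi.single k δ) c =
      Finsupp.linearCombination ℚ x c + c k * δ := by
    intro c
    induction c using Finsupp.induction_linear with
    | zero => simp
    | add c d hc hd => simp only [map_add, hc, hd, Finsupp.add_apply]; ring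
    | single j q =>
      by_cases h : j = k
      · subst h; simp [mul_add]
      · simp [h]
  simp only [eval, this]
  ring

end Aff

open Classical in
/-- Fourier–Motzkin elimination of all unknowns from finitely many strict inequalities. -/
theorem exists_elimination_of_support (S : Finset K) (pos : List (Aff K VS FS))
    (hS : ∀ a ∈ pos, a.coef.support ⊆ S) :
    ∃ p : STm VS FS .bool, ∀ (I : Interp Fn) (ν : Val V),
      p.1.eval I ν = true ↔ ∃ x : K → ℚ, ∀ a ∈ pos, 0 < a.eval I ν x := by
  induction S using Finset.induction_on generalizing pos with
  | empty =>
    refine ⟨STm.conj (pos.map fun a => (STm.const 0).lt a.rest), fun I ν => ?_⟩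
    have h0 : ∀ a ∈ pos, ∀ x, a.eval I ν x = (a.rest.1.eval I ν : ℚ) := fun a ha =>
      Aff.eval_of_coef_eq_zero (Finsupp.support_eq_empty.1 (Finset.subset_empty.1 (hS a ha))) I ν
    rw [STm.eval_conj, List.forall_mem_map]
    constructor
    · exact fun h => ⟨0, fun a ha => by rw [h0 a ha]; exact (STm.eval_lt _ _ I ν).1 (h a ha)⟩
    · rintro ⟨x, h⟩ a ha
      refine (STm.eval_lt _ _ I ν).2 ?_
      rw [← h0 a ha x]; exact h a ha
  | insert k S hk ih =>
    let P := pos.filter fun a => 0 < a.coef k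
    let N := pos.filter fun a => a.coef k < 0
    let Z := pos.filter fun a => a.coef k = 0
    -- For `a` in `P` and `b` in `N` the multiplier is positive, so `comb a b` is a positive
    -- combination of `a` and `b` in which `k` cancels.
    let comb : Aff K VS FS → Aff K VS FS → Aff K VS FS :=
      fun a b => a.addSMul (-(a.coef k / b.coef k)) b
    let pos' := Z ++ P.flatMap fun a => N.map fun b => comb a b
    obtain ⟨p, hp⟩ := ih pos' (by
      intro a ha
      have hak : a.coef k = 0 ∧ a.coef.support ⊆ insert k S := by
        rcases List.mem_append.1 ha with ha | ha
        · have := List.mem_filter.1 ha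
          exact ⟨by simpa using this.2, hS a this.1⟩
        · obtain ⟨b, hb, ha⟩ := List.mem_flatMap.1 ha
          obtain ⟨c, hc, rfl⟩ := List.mem_map.1 ha
          have hb := List.mem_filter.1 hb
          have hc := List.mem_filter.1 hc
          have hc0 : c.coef k ≠ 0 := by
            have := hc.2
            simp only [decide_eq_true_eq] at this
            exact this.ne
          refine ⟨?_, ?_⟩
          · simp only [comb, Aff.addSMul, Finsupp.add_apply, Finsupp.smul_apply, smul_eq_mul]
            field_simp
            ring
          · exact Finsupp.support_add.trans (Finset.union_subset (hS b hb.1)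
              (Finsupp.support_smul.trans (hS c hc.1)))
      intro j hj
      rcases Finset.mem_insert.1 (hak.2 hj) with rfl | h
      · exact absurd hak.1 (Finsupp.mem_support_iff.1 hj)
      · exact h)
    refine ⟨p, fun I ν => (hp I ν).trans ⟨?_, ?_⟩⟩
    · rintro ⟨x, hx⟩
      have hZ : ∀ a ∈ pos, a.coef k = 0 → 0 < a.eval I ν x := fun a ha h =>
        hx a (List.mem_append_left _ (List.mem_filter.2 ⟨ha, by simpa using h⟩))
      have hPN : ∀ a ∈ pos, 0 < a.coef k → ∀ b ∈ pos, b.coef k < 0 →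
          -(a.eval I ν x / a.coef k) < -(b.eval I ν x / b.coef k) := by
        intro a ha hak b hb hbk
        have := hx (comb a b) (List.mem_append_right _ (List.mem_flatMap.2
          ⟨a, List.mem_filter.2 ⟨ha, by simpa using hak⟩, List.mem_map.2
            ⟨b, List.mem_filter.2 ⟨hb, by simpa using hbk⟩, rfl⟩⟩))
        simp only [comb, Aff.eval_addSMul] at this
        have h2 : b.eval I ν x / b.coef k < a.eval I ν x / a.coef k := by
          rw [lt_div_iff₀ hak]
          have : a.coef k / b.coef k * b.eval I ν x = b.eval I ν x / b.coef k * a.coef k := by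
            ring
          linarith
        linarith
      -- Here `δ` is a displacement of coordinate `k`: forms in `P` bound it from below and forms in
      -- `N` from above. The rationals are dense and unbounded, so a value exists even if one of the
      -- sets is empty.
      obtain ⟨δ, h1, h2⟩ := Order.exists_between_finsets
        (P.map fun a => -(a.eval I ν x / a.coef k)).toFinset
        (N.map fun a => -(a.eval I ν x / a.coef k)).toFinset (by
          simp only [P, N, List.mem_toFinset, List.forall_mem_map, List.mem_filter,
            decide_eq_true_eq]
          exact fun a ha b hb => hPN a ha.1 ha.2 b hb.1 hb.2)
      simp only [P, N, List.mem_toFinset, List.forall_mem_map, List.mem_filter,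
            decide_eq_true_eq] at h1 h2
      refine ⟨x + Pi.single k δ, fun a ha => ?_⟩
      rw [Aff.eval_shift]
      rcases lt_trichotomy (a.coef k) 0 with h | h | h
      · have := h2 a ⟨ha, h⟩
        have h3 : a.eval I ν x / a.coef k * a.coef k = a.eval I ν x := div_mul_cancel₀ _ h.ne
        nlinarith
      · rw [h]; simpa using hZ a ha h
      · have := h1 a ⟨ha, h⟩
        have h3 : a.eval I ν x / a.coef k * a.coef k = a.eval I ν x := div_mul_cancel₀ _ h.ne'
        nlinarith
    · rintro ⟨x, hx⟩
      refine ⟨x, fun a ha => ?_⟩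
      rcases List.mem_append.1 ha with ha | ha
      · exact hx a (List.mem_filter.1 ha).1
      · obtain ⟨b, hb, ha⟩ := List.mem_flatMap.1 ha
        obtain ⟨c, hc, rfl⟩ := List.mem_map.1 ha
        have hb := List.mem_filter.1 hb
        have hc := List.mem_filter.1 hc
        have hb2 : 0 < b.coef k := by simpa using hb.2
        have hc2 : c.coef k < 0 := by simpa using hc.2
        simp only [comb, Aff.eval_addSMul]
        have := div_neg_of_pos_of_neg hb2 hc2
        have := mul_pos (neg_pos.2 this) (hx c hc.1)
        linarith [hx b hb.1]

theorem exists_elimination (pos : List (Aff K VS FS)) :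
    ∃ p : STm VS FS .bool, ∀ (I : Interp Fn) (ν : Val V),
      p.1.eval I ν = true ↔ ∃ x : K → ℚ, ∀ a ∈ pos, 0 < a.eval I ν x := by
  classical
  exact exists_elimination_of_support (pos.toFinset.biUnion fun a => a.coef.support) pos
    fun a ha => Finset.subset_biUnion_of_mem (fun a : Aff K VS FS => a.coef.support)
      (List.mem_toFinset.2 ha)

open Filter Topology in
/-- A solution of strict inequalities can be perturbed so that finitely many nonconstant affine
forms avoid a finite set. -/
theorem exists_generic_solution (pos gen : List (Aff K VS FS)) (I : Interp Fn) (ν : Val V)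
    (hgen : ∀ a ∈ gen, a.coef ≠ 0) {E : Set ℚ} (hE : E.Finite) {x : K → ℚ}
    (hx : ∀ a ∈ pos, 0 < a.eval I ν x) :
    ∃ y : K → ℚ, (∀ a ∈ pos, 0 < a.eval I ν y) ∧ ∀ a ∈ gen, a.eval I ν y ∉ E := by
  classical
  induction gen with
  | nil => exact ⟨x, hx, by simp⟩
  | cons b gen ih =>
    obtain ⟨y, hy, hyg⟩ := ih fun a ha => hgen a (List.mem_cons_of_mem _ ha)
    obtain ⟨k, hk⟩ := Finsupp.ne_iff.1 (hgen b List.mem_cons_self)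
    have ht : ∀ a : Aff K VS FS, Tendsto (fun δ : ℚ => a.eval I ν y + a.coef k * δ) (𝓝[≠] 0)
        (𝓝 (a.eval I ν y)) := fun a => by
      have : Continuous fun δ : ℚ => a.eval I ν y + a.coef k * δ := by fun_prop
      simpa using (this.tendsto 0).mono_left nhdsWithin_le_nhds
    have h1 : ∀ᶠ δ in 𝓝[≠] (0 : ℚ), ∀ a ∈ pos.toFinset, 0 < a.eval I ν y + a.coef k * δ :=
      (Filter.eventually_all_finset _).2 fun a ha =>
        (ht a).eventually (lt_mem_nhds (hy a (List.mem_toFinset.1 ha)))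
    have h2 : ∀ᶠ δ in 𝓝[≠] (0 : ℚ), ∀ a ∈ gen.toFinset, a.eval I ν y + a.coef k * δ ∉ E :=
      (Filter.eventually_all_finset _).2 fun a ha =>
        (ht a).eventually (hE.isClosed.isOpen_compl.mem_nhds (hyg a (List.mem_toFinset.1 ha)))
    -- Along direction `k` the form `b` has nonzero slope. A value that equals `e` is left by every
    -- nonzero `δ`; any other value stays away from `e` by continuity.
    have h3 : ∀ᶠ δ in 𝓝[≠] (0 : ℚ), ∀ e ∈ hE.toFinset, b.eval I ν y + b.coef k * δ ≠ e := by
      refine (Filter.eventually_all_finset _).2 fun e _ => ?_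
      by_cases he : b.eval I ν y = e
      · filter_upwards [self_mem_nhdsWithin] with δ hδ h
        rw [he, add_eq_left] at h
        exact (mul_ne_zero hk hδ) h
      · exact (ht b).eventually (isOpen_ne.mem_nhds he)
    obtain ⟨δ, h1, h2, h3⟩ := (h1.and (h2.and h3)).exists
    refine ⟨y + Pi.single k δ, fun a ha => ?_, fun a ha => ?_⟩
    · rw [Aff.eval_shift]; exact h1 a (List.mem_toFinset.2 ha)
    · rw [Aff.eval_shift]
      rcases List.mem_cons.1 ha with rfl | ha
      · exact fun h => h3 _ (hE.mem_toFinset.2 h) rfl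
      · exact h2 a (List.mem_toFinset.2 ha)

end Systems

/-! ### Linear systems with application constraints, and the operations that simplify them. -/

section Separation

variable {Fn : List Ty → Ty → Type} {V : Ty → Type} {K : Type} {VS : Set (AllVar V)}
  {FS : Set (AllFn Fn)}

/-- Arguments and results of function applications: affine forms and truth values. -/
abbrev Arg (K : Type) (VS : Set (AllVar V)) (FS : Set (AllFn Fn)) : Ty → Type
  | .num => Aff K VS FS
  | .bool => Bool

/-- The value of an argument. -/
noncomputable def Arg.eval (I : Interp Fn) (ν : Val V) (x : K → ℚ) :
    {s : Ty} → Arg K VS FS s → Dom s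
  | .num, a => Aff.eval a I ν x
  | .bool, b => b

/-- A constraint: the value of `f` at `args` is `val`. -/
structure App (K : Type) (VS : Set (AllVar V)) (FS : Set (AllFn Fn)) where
  /-- the argument types -/
  ds : List Ty
  /-- the result type -/
  s : Ty
  /-- the function symbol -/
  f : Fn ds s
  /-- the arguments -/
  args : (i : Fin ds.length) → Arg K VS FS (ds.get i)
  /-- the result -/
  val : Arg K VS FS s

/-- Satisfaction of an application constraint. -/
def App.Holds (a : App K VS FS) (I : Interp Fn) (ν : Val V) (x : K → ℚ) : Prop :=
  I a.ds a.s a.f (fun i => (a.args i).eval I ν x) = a.val.eval I ν x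

/-- Systems of equations, strict inequalities and side conditions. -/
structure Sys (K : Type) (VS : Set (AllVar V)) (FS : Set (AllFn Fn)) where
  /-- the forms that vanish -/
  eqs : List (Aff K VS FS)
  /-- the positive forms -/
  pos : List (Aff K VS FS)
  /-- the conditions on the parameters -/
  cond : List (STm VS FS .bool)

/-- Satisfaction of a system. -/
def Sys.Sat (P : Sys K VS FS) (I : Interp Fn) (ν : Val V) (x : K → ℚ) : Prop :=
  (∀ a ∈ P.eqs, a.eval I ν x = 0) ∧ (∀ a ∈ P.pos, 0 < a.eval I ν x) ∧
    ∀ c ∈ P.cond, c.1.eval I ν = true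

/-- In every solution of `P`, the application constraints are consistent. -/
def Sys.Cong (P : Sys K VS FS) (apps : List (App K VS FS)) : Prop :=
  ∀ (ds : List Ty) (s : Ty) (f : Fn ds s) (args args' : (i : Fin ds.length) → Arg K VS FS (ds.get i))
    (val val' : Arg K VS FS s), ⟨ds, s, f, args, val⟩ ∈ apps → ⟨ds, s, f, args', val'⟩ ∈ apps →
    ∀ (I : Interp Fn) (ν : Val V) (x : K → ℚ), P.Sat I ν x →
      (∀ i, (args i).eval I ν x = (args' i).eval I ν x) → val.eval I ν x = val'.eval I ν x

/-- A set of models depends only on the values of the variables in `VB` and on the interpretation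
of the symbols in `FB` at finitely many arguments. -/
def FinDep (VB : Set (AllVar V)) (FB : Set (AllFn Fn)) (B : Interp Fn → Val V → Prop) : Prop :=
  ∀ (I : Interp Fn) (ν : Val V), B I ν → ∃ E : Set ((s : Ty) × Dom s), E.Finite ∧
    ∀ (J : Interp Fn) (ν' : Val V), AgreeOn FB E I J → AgreeVar VB ν ν' → B J ν'

/-- A formula over `VS` and `FS` separates `A` from `B`. -/
def Separable (VS : Set (AllVar V)) (FS : Set (AllFn Fn)) (A B : Interp Fn → Val V → Prop) :
    Prop :=
  ∃ p : STm VS FS .bool, (∀ I ν, A I ν → p.1.eval I ν = true) ∧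
    ∀ I ν, p.1.eval I ν = true → ¬ B I ν

theorem Separable.mono {A A' B : Interp Fn → Val V → Prop} (h : Separable VS FS A B)
    (hA : ∀ I ν, A' I ν → A I ν) : Separable VS FS A' B := by
  obtain ⟨p, h1, h2⟩ := h
  exact ⟨p, fun I ν h => h1 I ν (hA I ν h), h2⟩

theorem separable_of_forall_not {A B : Interp Fn → Val V → Prop} (h : ∀ I ν, ¬ A I ν) :
    Separable VS FS A B :=
  ⟨STm.ofBool false, fun I ν hA => absurd hA (h I ν), fun I ν hp => by
    rw [STm.eval_ofBool] at hp; cases hp⟩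

theorem Separable.or {A A' B : Interp Fn → Val V → Prop} (h : Separable VS FS A B)
    (h' : Separable VS FS A' B) : Separable VS FS (fun I ν => A I ν ∨ A' I ν) B := by
  obtain ⟨p, h1, h2⟩ := h
  obtain ⟨q, h3, h4⟩ := h'
  refine ⟨p.or q, fun I ν h => ?_, fun I ν h => ?_⟩
  · exact (STm.eval_or p q I ν).2 (h.imp (h1 I ν) (h3 I ν))
  · exact ((STm.eval_or p q I ν).1 h).elim (h2 I ν) (h4 I ν)

theorem separable_biUnion {ι : Type*} (T : Finset ι) {A : ι → Interp Fn → Val V → Prop}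
    {B : Interp Fn → Val V → Prop} (h : ∀ i ∈ T, Separable VS FS (A i) B) :
    Separable VS FS (fun I ν => ∃ i ∈ T, A i I ν) B := by
  classical
  induction T using Finset.induction_on with
  | empty => exact separable_of_forall_not (by simp)
  | insert i T hi ih =>
    refine ((h i (Finset.mem_insert_self i T)).or
      (ih fun j hj => h j (Finset.mem_insert_of_mem hj))).mono ?_
    rintro I ν ⟨j, hj, hA⟩
    rcases Finset.mem_insert.1 hj with rfl | hj
    · exact Or.inl hA
    · exact Or.inr ⟨j, hj, hA⟩

/-- The constraint `a = t` can be added to a system. -/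
theorem Sys.exists_add_eq (P : Sys K VS FS) {s : Ty} (a : Arg K VS FS s) (t : STm VS FS s) :
    ∃ P' : Sys K VS FS, ∀ I ν x, P'.Sat I ν x ↔ P.Sat I ν x ∧ a.eval I ν x = t.1.eval I ν := by
  match s, a, t with
  | .num, a, t =>
    refine ⟨⟨Aff.addSMul a (-1) (Aff.ofTm t) :: P.eqs, P.pos, P.cond⟩, fun I ν x => ?_⟩
    have : (Aff.addSMul a (-1) (Aff.ofTm t)).eval I ν x = 0 ↔
        Arg.eval I ν x (s := .num) a = t.1.eval I ν := by
      rw [Aff.eval_addSMul, Aff.eval_of_coef_eq_zero (a := Aff.ofTm t) rfl, neg_one_mul,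
        ← sub_eq_add_neg, sub_eq_zero]
      rfl
    simp only [Sys.Sat, List.forall_mem_cons, this]
    tauto
  | .bool, a, t =>
    refine ⟨⟨P.eqs, P.pos, (STm.ofBool a).eq t :: P.cond⟩, fun I ν x => ?_⟩
    have : ((STm.ofBool a).eq t).1.eval I ν = true ↔
        Arg.eval (VS := VS) (FS := FS) I ν x (s := .bool) a = t.1.eval I ν := by
      rw [STm.eval_eq, STm.eval_ofBool]
      rfl
    simp only [Sys.Sat, List.forall_mem_cons, this]
    tauto

open Classical in
/-- Substitution of the solution of `e = 0` for the unknown `k`. -/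
theorem Aff.eval_shift_solve (a e : Aff K VS FS) (k : K) (hk : e.coef k ≠ 0) (I : Interp Fn)
    (ν : Val V) (x : K → ℚ) :
    a.eval I ν (x + Pi.single k (-(e.eval I ν x / e.coef k))) =
      (a.addSMul (-(a.coef k / e.coef k)) e).eval I ν x := by
  rw [Aff.eval_shift, Aff.eval_addSMul]
  field_simp

/-- Elimination of the unknown `k` in an argument by means of the equation `e = 0`. -/
noncomputable def Arg.solve (e : Aff K VS FS) (k : K) :
    {s : Ty} → Arg K VS FS s → Arg K VS FS s
  | .num, a => Aff.addSMul a (-(Aff.coef a k / e.coef k)) e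
  | .bool, b => b

/-- Elimination of the unknown `k` in an application constraint. -/
noncomputable def App.solve (e : Aff K VS FS) (k : K) (a : App K VS FS) : App K VS FS :=
  ⟨a.ds, a.s, a.f, fun i => (a.args i).solve e k, a.val.solve e k⟩

theorem Arg.eval_solve_of_eq_zero {e : Aff K VS FS} {k : K} {I : Interp Fn} {ν : Val V}
    {x : K → ℚ} (he : e.eval I ν x = 0) {s : Ty} (a : Arg K VS FS s) :
    (a.solve e k).eval I ν x = a.eval I ν x := by
  match s, a with
  | .num, a =>
    simp only [Arg.solve, Arg.eval]
    rw [Aff.eval_addSMul, he, mul_zero, add_zero]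
  | .bool, a => rfl

-- Substituting the solution of `e = 0` amounts to first moving coordinate `k` to where `e`
-- vanishes. This holds at every point, so solutions of the reduced system lift to the original one;
-- `Arg.eval_solve_of_eq_zero` serves the converse direction.
open Classical in
theorem Arg.eval_solve {e : Aff K VS FS} {k : K} (hk : e.coef k ≠ 0) (I : Interp Fn) (ν : Val V)
    (x : K → ℚ) {s : Ty} (a : Arg K VS FS s) :
    (a.solve e k).eval I ν x = a.eval I ν (x + Pi.single k (-(e.eval I ν x / e.coef k))) := by
  match s, a with
  | .num, a => exact (Aff.eval_shift_solve a e k hk I ν x).symm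
  | .bool, a => rfl

/-- The argument contains no unknowns. -/
def Arg.IsConst : {s : Ty} → Arg K VS FS s → Prop
  | .num, a => Aff.coef a = 0
  | .bool, _ => True

theorem Arg.IsConst.exists_tm {s : Ty} {a : Arg K VS FS s} (h : a.IsConst) :
    ∃ t : STm VS FS s, ∀ I ν x, t.1.eval I ν = a.eval I ν x := by
  match s, a, h with
  | .num, a, h => exact ⟨Aff.rest a, fun I ν x => (Aff.eval_of_coef_eq_zero h I ν x).symm⟩
  | .bool, a, _ => exact ⟨STm.ofBool a, fun I ν x => STm.eval_ofBool a I ν⟩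

/-- The function symbol is shared and the arguments contain no unknowns. -/
def App.IsClosed (a : App K VS FS) : Prop :=
  ⟨a.ds, a.s, a.f⟩ ∈ FS ∧ ∀ i, (a.args i).IsConst

/-- This permits trading a closed constraint for an equation between its result and a term of the
common language. -/
theorem App.IsClosed.exists_tm {a : App K VS FS} (h : a.IsClosed) :
    ∃ t : STm VS FS a.s, ∀ I ν x,
      t.1.eval I ν = I a.ds a.s a.f (fun i => (a.args i).eval I ν x) := by
  have key := fun i => (h.2 i).exists_tm
  choose t ht using key
  refine ⟨⟨.app a.f fun i => (t i).1, Set.iUnion_subset fun i => (t i).2.1,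
    Set.union_subset (Set.singleton_subset_iff.2 h.1) (Set.iUnion_subset fun i => (t i).2.2)⟩,
    fun I ν x => ?_⟩
  simp only [Tm.eval, ht _ I ν x]

end Separation

/-! ### Separation theorem for systems with application constraints. -/

section Separation

variable {Fn : List Ty → Ty → Type} {V : Ty → Type} {K : Type} {VS VB : Set (AllVar V)}
  {FS FB : Set (AllFn Fn)}

theorem STm.exists_finite_support {s : Ty} (t : STm VS FS s) (I : Interp Fn) (ν : Val V) :
    ∃ E : Set ((s : Ty) × Dom s), E.Finite ∧
      ∀ J : Interp Fn, AgreeOn FS E I J → t.1.eval J ν = t.1.eval I ν := by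
  obtain ⟨E, hE, h⟩ := t.1.exists_finite_support I ν
  exact ⟨E, hE, fun J hJ => h J ν (hJ.mono t.2.2 subset_rfl) fun _ _ => rfl⟩

theorem Arg.exists_finite_support {s : Ty} (a : Arg K VS FS s) (I : Interp Fn) (ν : Val V) :
    ∃ E : Set ((s : Ty) × Dom s), E.Finite ∧
      ∀ J : Interp Fn, AgreeOn FS E I J → ∀ x, a.eval J ν x = a.eval I ν x := by
  match s, a with
  | .num, a =>
    obtain ⟨E, hE, h⟩ := STm.exists_finite_support (Aff.rest a) I ν
    refine ⟨E, hE, fun J hJ x => ?_⟩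
    simp only [Arg.eval, Aff.eval, h J hJ]
  | .bool, a => exact ⟨∅, Set.finite_empty, fun _ _ _ => rfl⟩

theorem exists_finite_support_list {α : Type*} (l : List α) (I : Interp Fn)
    (Q : α → Interp Fn → Prop)
    (h : ∀ a, ∃ E : Set ((s : Ty) × Dom s), E.Finite ∧ ∀ J, AgreeOn FS E I J → Q a J) :
    ∃ E : Set ((s : Ty) × Dom s), E.Finite ∧ ∀ J, AgreeOn FS E I J → ∀ a ∈ l, Q a J := by
  choose E hE h using h
  refine ⟨⋃ a ∈ {a | a ∈ l}, E a, l.finite_toSet.biUnion fun a _ => hE a, fun J hJ a ha => ?_⟩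
  exact h a J (hJ.mono subset_rfl (Set.subset_biUnion_of_mem (u := E) ha))

/-- All application constraints are about values that occur nowhere else. -/
theorem separable_of_forall_not_isClosed (P : Sys K VS FS) (apps : List (App K VS FS))
    {B : Interp Fn → Val V → Prop} (heqs : P.eqs = []) (hFS : FS ⊆ FB)
    (happs : ∀ a ∈ apps, (⟨a.ds, a.s, a.f⟩ : AllFn Fn) ∈ FB → (⟨a.ds, a.s, a.f⟩ : AllFn Fn) ∈ FS)
    (hclosed : ∀ a ∈ apps, ¬ a.IsClosed) (hcong : P.Cong apps) (hB : FinDep VB FB B)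
    (hdisj : ∀ I ν x, P.Sat I ν x → (∀ a ∈ apps, a.Holds I ν x) → ¬ B I ν) :
    Separable VS FS (fun I ν => ∃ x, P.Sat I ν x ∧ ∀ a ∈ apps, a.Holds I ν x) B := by
  classical
  obtain ⟨p, hp⟩ := exists_elimination P.pos
  -- The application constraints leave no trace in the separating formula: in any model of it and of
  -- `B`, they can be made true by redefining functions where nothing else looks.
  refine ⟨p.and (STm.conj P.cond), ?_, ?_⟩
  · rintro I ν ⟨x, hx, -⟩
    rw [STm.eval_and, STm.eval_conj, hp]
    exact ⟨⟨x, hx.2.1⟩, hx.2.2⟩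
  intro I ν hI hBI
  rw [STm.eval_and, STm.eval_conj, hp] at hI
  obtain ⟨⟨x₀, hx₀⟩, hcond⟩ := hI
  obtain ⟨E₀, hE₀, hB₀⟩ := hB I ν hBI
  obtain ⟨E₁, hE₁, h₁⟩ := exists_finite_support_list P.pos I
    (fun a J => ∀ x, a.eval J ν x = a.eval I ν x)
    (fun a => Arg.exists_finite_support (s := .num) a I ν)
  obtain ⟨E₂, hE₂, h₂⟩ := exists_finite_support_list P.cond I
    (fun a J => a.1.eval J ν = a.1.eval I ν) (fun a => a.exists_finite_support I ν)
  obtain ⟨E₃, hE₃, h₃⟩ := exists_finite_support_list apps I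
    (fun a J => ∀ i x, (a.args i).eval J ν x = (a.args i).eval I ν x) (fun a => by
      choose E hE h using fun i => (a.args i).exists_finite_support I ν
      exact ⟨⋃ i, E i, Set.finite_iUnion hE, fun J hJ i =>
        h i J (hJ.mono subset_rfl (Set.subset_iUnion E i))⟩)
  obtain ⟨E₄, hE₄, h₄⟩ := exists_finite_support_list apps I
    (fun a J => ∀ x, a.val.eval J ν x = a.val.eval I ν x)
    (fun a => a.val.exists_finite_support I ν)
  -- An interpretation agreeing with `I` for the symbols of `FB` on `E` preserves `B`, the
  -- inequalities, the conditions, and the arguments and results of all constraints.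
  let E := E₀ ∪ E₁ ∪ E₂ ∪ E₃ ∪ E₄
  have hE : E.Finite := (((hE₀.union hE₁).union hE₂).union hE₃).union hE₄
  let EQ : Set ℚ := {q | (⟨.num, q⟩ : (s : Ty) × Dom s) ∈ E}
  have hEQ : EQ.Finite := hE.preimage fun a _ b _ h => by simpa using h
  have hgen : ∀ a ∈ apps, a.IsClosed ∨ (⟨a.ds, a.s, a.f⟩ : AllFn Fn) ∉ FS ∨
      ∃ g : Aff K VS FS, g.coef ≠ 0 ∧ ∀ x, g.eval I ν x ∉ EQ →
        ∃ i, (⟨a.ds.get i, (a.args i).eval I ν x⟩ : (s : Ty) × Dom s) ∉ E := by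
    intro a _
    by_cases hf : (⟨a.ds, a.s, a.f⟩ : AllFn Fn) ∈ FS
    swap
    · exact Or.inr (Or.inl hf)
    by_cases hc : ∀ i, (a.args i).IsConst
    · exact Or.inl ⟨hf, hc⟩
    · obtain ⟨i, hi⟩ := not_forall.1 hc
      refine Or.inr (Or.inr ?_)
      have aux : ∀ {s : Ty} (b : Arg K VS FS s), ¬ b.IsConst → ∃ g : Aff K VS FS, g.coef ≠ 0 ∧
          ∀ x, g.eval I ν x ∉ EQ → (⟨s, b.eval I ν x⟩ : (s : Ty) × Dom s) ∉ E := by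
        intro s b hb
        match s, b, hb with
        | .num, b, hb => exact ⟨b, hb, fun x hx => hx⟩
        | .bool, b, hb => exact absurd trivial hb
      obtain ⟨g, hg, h⟩ := aux _ hi
      exact ⟨g, hg, fun x hx => ⟨i, h x hx⟩⟩
  have hlist : ∀ l : List (App K VS FS), (∀ a ∈ l, a ∈ apps) →
      ∃ gen : List (Aff K VS FS), (∀ g ∈ gen, g.coef ≠ 0) ∧
        ∀ x, (∀ g ∈ gen, g.eval I ν x ∉ EQ) → ∀ a ∈ l, (⟨a.ds, a.s, a.f⟩ : AllFn Fn) ∈ FS →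
          ∃ i, (⟨a.ds.get i, (a.args i).eval I ν x⟩ : (s : Ty) × Dom s) ∉ E := by
    intro l
    induction l with
    | nil => exact fun _ => ⟨[], by simp, by simp⟩
    | cons a l ih =>
      intro hl
      obtain ⟨gen, hg, h⟩ := ih fun b hb => hl b (List.mem_cons_of_mem _ hb)
      rcases hgen a (hl a List.mem_cons_self) with hc | hf | ⟨g, hg', h'⟩
      · exact absurd hc (hclosed a (hl a List.mem_cons_self))
      · refine ⟨gen, hg, fun x hx b hb hbf => ?_⟩
        rcases List.mem_cons.1 hb with rfl | hb
        · exact absurd hbf hf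
        · exact h x hx b hb hbf
      · refine ⟨g :: gen, List.forall_mem_cons.2 ⟨hg', hg⟩, fun x hx b hb hbf => ?_⟩
        have hx := List.forall_mem_cons.1 hx
        rcases List.mem_cons.1 hb with rfl | hb
        · exact h' x hx.1
        · exact h x hx.2 b hb hbf
  obtain ⟨gen, hg0, hg⟩ := hlist apps fun _ h => h
  -- A constraint with a shared symbol that is not closed has a nonconstant argument, necessarily
  -- numeric. The perturbation pushes all these arguments out of the finite set `EQ` without
  -- violating an inequality.
  obtain ⟨x, hx, hxg⟩ := exists_generic_solution P.pos gen I ν hg0 hEQ hx₀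
  have hfresh := hg x hxg
  have hsat : P.Sat I ν x := ⟨by simp [heqs], hx, hcond⟩
  -- `J` takes the prescribed result at every argument tuple that occurs in a constraint, and is `I`
  -- elsewhere.
  let J : Interp Fn := fun ds s f d =>
    if h : ∃ (args : (i : Fin ds.length) → Arg K VS FS (ds.get i)) (val : Arg K VS FS s),
        ⟨ds, s, f, args, val⟩ ∈ apps ∧ ∀ i, (args i).eval I ν x = d i
    then h.choose_spec.choose.eval I ν x else I ds s f d
  have hJ : AgreeOn FB E I J := by
    intro ds s f hf d hd
    by_cases h : ∃ (args : (i : Fin ds.length) → Arg K VS FS (ds.get i)) (val : Arg K VS FS s),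
        ⟨ds, s, f, args, val⟩ ∈ apps ∧ ∀ i, (args i).eval I ν x = d i
    · obtain ⟨args, val, hmem, hargs⟩ := h
      obtain ⟨i, hi⟩ := hfresh _ hmem (happs _ hmem hf)
      exact absurd (by rw [hargs i]; exact hd i) hi
    · simp only [J, dif_neg h]
  have hJS : AgreeOn FS E I J := hJ.mono hFS subset_rfl
  have hJapp : ∀ a ∈ apps, a.Holds J ν x := by
    intro a ha
    have h3 := h₃ J (hJS.mono subset_rfl fun _ h => Or.inl (Or.inr h)) a ha
    have h4 := h₄ J (hJS.mono subset_rfl fun _ h => Or.inr h) a ha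
    have h : ∃ (args : (i : Fin a.ds.length) → Arg K VS FS (a.ds.get i)) (val : Arg K VS FS a.s),
        ⟨a.ds, a.s, a.f, args, val⟩ ∈ apps ∧
          ∀ i, (args i).eval I ν x = (a.args i).eval I ν x := ⟨a.args, a.val, ha, fun _ => rfl⟩
    -- The result chosen by `J` may stem from a different constraint with the same argument values;
    -- `hcong` makes the two results agree.
    have hs := h.choose_spec.choose_spec
    simp only [App.Holds, h3, h4, J, dif_pos h]
    exact hcong _ _ _ _ _ _ _ hs.1 ha I ν x hsat hs.2
  refine hdisj J ν x ⟨by simp [heqs], fun a ha => ?_, fun c hc => ?_⟩ hJapp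
    (hB₀ J ν (hJ.mono subset_rfl fun _ h => Or.inl (Or.inl (Or.inl (Or.inl h)))) fun _ _ => rfl)
  · rw [h₁ J (hJS.mono subset_rfl fun _ h => Or.inl (Or.inl (Or.inl (Or.inr h)))) a ha]
    exact hx a ha
  · rw [h₂ J (hJS.mono subset_rfl fun _ h => Or.inl (Or.inl (Or.inr h))) c hc]
    exact hcond c hc

/-- Separation of the models that admit a solution of a system with consistent application
constraints. -/
theorem separable_of_sys {B : Interp Fn → Val V → Prop} (hFS : FS ⊆ FB) (hB : FinDep VB FB B)
    (n m : ℕ) (P : Sys K VS FS) (apps : List (App K VS FS)) (hn : apps.length = n)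
    (hm : P.eqs.length = m)
    (happs : ∀ a ∈ apps, (⟨a.ds, a.s, a.f⟩ : AllFn Fn) ∈ FB → (⟨a.ds, a.s, a.f⟩ : AllFn Fn) ∈ FS)
    (hcong : P.Cong apps)
    (hdisj : ∀ I ν x, P.Sat I ν x → (∀ a ∈ apps, a.Holds I ν x) → ¬ B I ν) :
    Separable VS FS (fun I ν => ∃ x, P.Sat I ν x ∧ ∀ a ∈ apps, a.Holds I ν x) B := by
  classical
  -- The induction is lexicographic: first on the number of constraints, then on the number of
  -- equations. Closing a constraint lowers the former but may add an equation; solving an equation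
  -- lowers the latter and keeps the former.
  induction n generalizing m P apps with
  | zero | succ n ihn =>
    induction m generalizing P apps with
    | zero =>
      have heqs := List.length_eq_zero_iff.1 hm
      by_cases hcl : ∃ a ∈ apps, a.IsClosed
      -- The first alternative settles `n = 0`, where there is no constraint; the second trades a
      -- closed constraint for an equation.
      · first
        | (obtain ⟨a, ha, -⟩ := hcl
           rw [List.length_eq_zero_iff.1 hn] at ha
           cases ha)
        | (obtain ⟨a, ha, hac⟩ := hcl
           obtain ⟨t, ht⟩ := hac.exists_tm
           obtain ⟨P', hP'⟩ := P.exists_add_eq a.val t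
           have hiff : ∀ I ν x, (P.Sat I ν x ∧ ∀ b ∈ apps, b.Holds I ν x) ↔
               (P'.Sat I ν x ∧ ∀ b ∈ apps.erase a, b.Holds I ν x) := by
             intro I ν x
             have hap : a.Holds I ν x ↔ a.val.eval I ν x = t.1.eval I ν := by
               rw [ht I ν x]; exact eq_comm
             rw [hP', ← hap]
             refine ⟨fun h => ⟨⟨h.1, h.2 a ha⟩, fun b hb => h.2 b (List.mem_of_mem_erase hb)⟩,
               fun h => ⟨h.1.1, fun b hb => ?_⟩⟩
             by_cases hba : b = a
             · exact hba ▸ h.1.2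
             · exact h.2 b ((List.mem_erase_of_ne hba).2 hb)
           refine (ihn P'.eqs.length P' (apps.erase a)
             (by rw [List.length_erase_of_mem ha, hn]; rfl) rfl
             (fun b hb => happs b (List.mem_of_mem_erase hb))
             (fun ds s f args args' val val' h h' I ν x hx => hcong ds s f args args' val val'
               (List.mem_of_mem_erase h) (List.mem_of_mem_erase h') I ν x ((hP' I ν x).1 hx).1)
             (fun I ν x hx hap => ?_)).mono ?_
           · have := (hiff I ν x).2 ⟨hx, hap⟩
             exact hdisj I ν x this.1 this.2
           · rintro I ν ⟨x, hx⟩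
             exact ⟨x, (hiff I ν x).1 hx⟩)
      · exact separable_of_forall_not_isClosed P apps heqs hFS happs
          (fun a ha h => hcl ⟨a, ha, h⟩) hcong hB hdisj
    | succ m ihm =>
      obtain ⟨e, es, he⟩ := List.exists_cons_of_length_eq_add_one hm
      have hes : es.length = m := by rw [he] at hm; simpa using hm
      by_cases hk : e.coef = 0
      · let P' : Sys K VS FS := ⟨es, P.pos, e.rest.eq (STm.const 0) :: P.cond⟩
        have hP' : ∀ I ν x, P'.Sat I ν x ↔ P.Sat I ν x := by
          intro I ν x
          have : (e.rest.eq (STm.const 0)).1.eval I ν = true ↔ e.eval I ν x = 0 := by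
            rw [STm.eval_eq, Aff.eval_of_coef_eq_zero hk]
            rfl
          simp only [Sys.Sat, P', List.forall_mem_cons, this, he]
          tauto
        refine (ihm P' apps hn hes happs (fun ds s f args args' val val' h h' I ν x hx =>
          hcong ds s f args args' val val' h h' I ν x ((hP' I ν x).1 hx))
          (fun I ν x hx => hdisj I ν x ((hP' I ν x).1 hx))).mono ?_
        rintro I ν ⟨x, hx, hap⟩
        exact ⟨x, (hP' I ν x).2 hx, hap⟩
      · obtain ⟨k, hk⟩ := Finsupp.ne_iff.1 hk
        rw [Finsupp.zero_apply] at hk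
        let P' : Sys K VS FS := ⟨es.map fun a => Arg.solve (s := .num) e k a,
          P.pos.map fun a => Arg.solve (s := .num) e k a, P.cond⟩
        -- The reduced system no longer constrains coordinate `k`; `y` resets that coordinate so
        -- that `e` vanishes, which turns its solutions into solutions of `P`.
        let y : Interp Fn → Val V → (K → ℚ) → K → ℚ := fun I ν x =>
          x + Pi.single k (-(e.eval I ν x / e.coef k))
        have hey : ∀ I ν x, e.eval I ν (y I ν x) = 0 := by
          intro I ν x
          simp only [y, Aff.eval_shift]
          field_simp
          ring
        have hsol : ∀ {I ν x} {s : Ty} (a : Arg K VS FS s),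
            (a.solve e k).eval I ν x = a.eval I ν (y I ν x) := fun a => Arg.eval_solve hk _ _ _ a
        have hsolA : ∀ {I ν x} (a : Aff K VS FS),
            Aff.eval (Arg.solve (s := .num) e k a) I ν x = a.eval I ν (y I ν x) :=
          fun a => hsol (s := .num) a
        have hP' : ∀ I ν x, P'.Sat I ν x → P.Sat I ν (y I ν x) := by
          intro I ν x hx
          simp only [Sys.Sat, P', List.forall_mem_map, hsolA] at hx
          refine ⟨?_, hx.2⟩
          rw [he]
          exact List.forall_mem_cons.2 ⟨hey I ν x, hx.1⟩
        have hap' : ∀ I ν x, (∀ a ∈ apps.map (App.solve e k), a.Holds I ν x) →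
            ∀ a ∈ apps, a.Holds I ν (y I ν x) := by
          intro I ν x h a ha
          have := h _ (List.mem_map_of_mem ha)
          simpa only [App.Holds, App.solve, hsol] using this
        refine (ihm P' (apps.map (App.solve e k)) (by simpa using hn) (by simpa [P'] using hes)
          ?_ ?_ ?_).mono ?_
        · intro a ha
          obtain ⟨b, hb, rfl⟩ := List.mem_map.1 ha
          exact happs b hb
        · intro ds s f args args' val val' h h' I ν x hx hargs
          obtain ⟨⟨ds, s, f, args, val⟩, hb, hbe⟩ := List.mem_map.1 h
          cases hbe
          obtain ⟨⟨ds', s', f', args', val'⟩, hb', hbe⟩ := List.mem_map.1 h'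
          cases hbe
          simp only [hsol] at hargs ⊢
          exact hcong ds s f args args' val val' hb hb' I ν _ (hP' I ν x hx) hargs
        · exact fun I ν x hx hap => hdisj I ν _ (hP' I ν x hx) (hap' I ν x hap)
        · rintro I ν ⟨x, hx, hap⟩
          have he0 : e.eval I ν x = 0 := hx.1 e (by rw [he]; exact List.mem_cons_self)
          have hA : ∀ a : Aff K VS FS, Aff.eval (Arg.solve (s := .num) e k a) I ν x =
            a.eval I ν x := fun a => Arg.eval_solve_of_eq_zero (s := .num) he0 a
          refine ⟨x, ⟨?_, ?_, hx.2.2⟩, ?_⟩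
          · simp only [P', List.forall_mem_map, hA]
            exact fun a ha => hx.1 a (by rw [he]; exact List.mem_cons_of_mem _ ha)
          · simp only [P', List.forall_mem_map, hA]
            exact hx.2.1
          · intro a ha
            obtain ⟨b, hb, rfl⟩ := List.mem_map.1 ha
            have := hap b hb
            simpa only [App.Holds, App.solve, Arg.eval_solve_of_eq_zero he0] using this

end Separation

/-! ### From formulae to systems: symbolic values of subterms and case distinctions on signs. -/

section Interpolation

variable {Fn : List Ty → Ty → Type} {V W : Ty → Type} {VS VB : Set (AllVar V)}
  {FS FB : Set (AllFn Fn)}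

/-- A numeric term as an affine form in its maximal nonarithmetic subterms. -/
noncomputable def Tm.toAff (VS : Set (AllVar V)) (FS : Set (AllFn Fn)) :
    {s : Ty} → Tm Fn W s → Aff (Tm Fn W .num) VS FS
  | .num, .var x => ⟨Finsupp.single (.var x) 1, STm.const 0⟩
  | .num, .app f args => ⟨Finsupp.single (.app f args) 1, STm.const 0⟩
  | _, .const q => Aff.ofTm (STm.const q)
  | _, .add a b => (a.toAff VS FS).addSMul 1 (b.toAff VS FS)
  | _, .smul q a => (Aff.ofTm (STm.const 0)).addSMul q (a.toAff VS FS)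
  | .bool, _ => Aff.ofTm (STm.const 0)

open Classical in
/-- The truth value of a formula in the solutions of `P`, where `τ` gives the truth values of the
variables and applications. -/
noncomputable def Tm.toTruth (P : Sys (Tm Fn W .num) VS FS) (τ : Tm Fn W .bool → Bool) :
    {s : Ty} → Tm Fn W s → Bool
  | .bool, .var x => τ (.var x)
  | .bool, .app f args => τ (.app f args)
  | _, .tt => true
  | _, .ff => false
  | _, .eq (s := .num) a b =>
      decide (∀ I ν x, P.Sat I ν x → (a.toAff VS FS).eval I ν x = (b.toAff VS FS).eval I ν x)
  | _, .eq (s := .bool) a b => decide (a.toTruth P τ = b.toTruth P τ)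
  | _, .lt a b =>
      decide (∀ I ν x, P.Sat I ν x → (a.toAff VS FS).eval I ν x < (b.toAff VS FS).eval I ν x)
  | _, .not p => !p.toTruth P τ
  | _, .and p q => p.toTruth P τ && q.toTruth P τ
  | _, .or p q => p.toTruth P τ || q.toTruth P τ
  | .num, _ => false

/-- A term as an argument of an application constraint. -/
noncomputable def Tm.toArg (P : Sys (Tm Fn W .num) VS FS) (τ : Tm Fn W .bool → Bool) :
    {s : Ty} → Tm Fn W s → Arg (Tm Fn W .num) VS FS s
  | .num, t => t.toAff VS FS
  | .bool, t => t.toTruth P τ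

/-- The system fixes the sign of the difference of `a` and `b`. -/
def Sys.Decides {K : Type} (P : Sys K VS FS) (a b : Aff K VS FS) : Prop :=
  (∀ I ν x, P.Sat I ν x → a.eval I ν x < b.eval I ν x) ∨
  (∀ I ν x, P.Sat I ν x → a.eval I ν x = b.eval I ν x) ∨
  (∀ I ν x, P.Sat I ν x → b.eval I ν x < a.eval I ν x)

/-- To separate the models that admit a solution of `P`, one may assume that `P` fixes the signs
of finitely many differences. -/
theorem separable_of_decides {K : Type} {B : Interp Fn → Val V → Prop}
    (Q : Interp Fn → Val V → (K → ℚ) → Prop) (l : List (Aff K VS FS × Aff K VS FS))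
    (P : Sys K VS FS)
    (h : ∀ P' : Sys K VS FS, (∀ I ν x, P'.Sat I ν x → P.Sat I ν x) →
      (∀ d ∈ l, P'.Decides d.1 d.2) → Separable VS FS (fun I ν => ∃ x, P'.Sat I ν x ∧ Q I ν x) B) :
    Separable VS FS (fun I ν => ∃ x, P.Sat I ν x ∧ Q I ν x) B := by
  induction l generalizing P with
  | nil => exact h P (fun _ _ _ h => h) (by simp)
  | cons d l ih =>
    obtain ⟨a, b⟩ := d
    let P₁ : Sys K VS FS := ⟨P.eqs, b.addSMul (-1) a :: P.pos, P.cond⟩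
    let P₂ : Sys K VS FS := ⟨a.addSMul (-1) b :: P.eqs, P.pos, P.cond⟩
    let P₃ : Sys K VS FS := ⟨P.eqs, a.addSMul (-1) b :: P.pos, P.cond⟩
    have h₁ : ∀ I ν x, P₁.Sat I ν x ↔ P.Sat I ν x ∧ a.eval I ν x < b.eval I ν x := by
      intro I ν x
      simp only [Sys.Sat, P₁, List.forall_mem_cons, Aff.eval_addSMul, neg_one_mul,
        ← sub_eq_add_neg, sub_pos]
      tauto
    have h₂ : ∀ I ν x, P₂.Sat I ν x ↔ P.Sat I ν x ∧ a.eval I ν x = b.eval I ν x := by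
      intro I ν x
      simp only [Sys.Sat, P₂, List.forall_mem_cons, Aff.eval_addSMul, neg_one_mul,
        ← sub_eq_add_neg, sub_eq_zero]
      tauto
    have h₃ : ∀ I ν x, P₃.Sat I ν x ↔ P.Sat I ν x ∧ b.eval I ν x < a.eval I ν x := by
      intro I ν x
      simp only [Sys.Sat, P₃, List.forall_mem_cons, Aff.eval_addSMul, neg_one_mul,
        ← sub_eq_add_neg, sub_pos]
      tauto
    -- By trichotomy the three refined systems cover `P`, and the disjunction of their separating
    -- formulae works for `P`.
    refine ((ih P₁ ?_).or ((ih P₂ ?_).or (ih P₃ ?_))).mono ?_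
    · exact fun P' hP' hd => h P' (fun I ν x hx => ((h₁ I ν x).1 (hP' I ν x hx)).1)
        (List.forall_mem_cons.2 ⟨Or.inl fun I ν x hx => ((h₁ I ν x).1 (hP' I ν x hx)).2, hd⟩)
    · exact fun P' hP' hd => h P' (fun I ν x hx => ((h₂ I ν x).1 (hP' I ν x hx)).1)
        (List.forall_mem_cons.2
          ⟨Or.inr (Or.inl fun I ν x hx => ((h₂ I ν x).1 (hP' I ν x hx)).2), hd⟩)
    · exact fun P' hP' hd => h P' (fun I ν x hx => ((h₃ I ν x).1 (hP' I ν x hx)).1)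
        (List.forall_mem_cons.2
          ⟨Or.inr (Or.inr fun I ν x hx => ((h₃ I ν x).1 (hP' I ν x hx)).2), hd⟩)
    · rintro I ν ⟨x, hx, hQ⟩
      rcases lt_trichotomy (a.eval I ν x) (b.eval I ν x) with hab | hab | hab
      · exact Or.inl ⟨x, (h₁ I ν x).2 ⟨hx, hab⟩, hQ⟩
      · exact Or.inr (Or.inl ⟨x, (h₂ I ν x).2 ⟨hx, hab⟩, hQ⟩)
      · exact Or.inr (Or.inr ⟨x, (h₃ I ν x).2 ⟨hx, hab⟩, hQ⟩)

/-- The three cases of `Decides` are mutually exclusive at a solution, so a single solution reveals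
which one holds throughout. This justifies that `Tm.toTruth` quantifies over all solutions. -/
theorem Sys.Decides.eq_iff {K : Type} {P : Sys K VS FS} {a b : Aff K VS FS} (h : P.Decides a b)
    {I : Interp Fn} {ν : Val V} {x : K → ℚ} (hx : P.Sat I ν x) :
    a.eval I ν x = b.eval I ν x ↔ ∀ I ν x, P.Sat I ν x → a.eval I ν x = b.eval I ν x := by
  refine ⟨fun he => ?_, fun h => h I ν x hx⟩
  rcases h with h | h | h
  · exact absurd he (h I ν x hx).ne
  · exact h
  · exact absurd he (h I ν x hx).ne'

theorem Sys.Decides.lt_iff {K : Type} {P : Sys K VS FS} {a b : Aff K VS FS} (h : P.Decides a b)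
    {I : Interp Fn} {ν : Val V} {x : K → ℚ} (hx : P.Sat I ν x) :
    a.eval I ν x < b.eval I ν x ↔ ∀ I ν x, P.Sat I ν x → a.eval I ν x < b.eval I ν x := by
  refine ⟨fun he => ?_, fun h => h I ν x hx⟩
  rcases h with h | h | h
  · exact h
  · exact absurd (h I ν x hx) he.ne
  · exact absurd (h I ν x hx) he.not_gt

/-- The system fixes the signs of all differences of numeric subterms of `A`. -/
def Sys.DecidesSubs (P : Sys (Tm Fn W .num) VS FS) {s : Ty} (A : Tm Fn W s) : Prop :=
  ∀ a b : Tm Fn W .num, ⟨.num, a⟩ ∈ A.subs → ⟨.num, b⟩ ∈ A.subs →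
    P.Decides (a.toAff VS FS) (b.toAff VS FS)

/-- The two solutions may belong to different models. Numeric equalities are fixed by the system,
and Boolean arguments are fixed truth values. -/
theorem Sys.DecidesSubs.toArg_eq {P : Sys (Tm Fn W .num) VS FS} {A : Tm Fn W .bool}
    (h : P.DecidesSubs A) (τ : Tm Fn W .bool → Bool) {s : Ty} {a b : Tm Fn W s}
    (ha : ⟨s, a⟩ ∈ A.subs) (hb : ⟨s, b⟩ ∈ A.subs) {I J : Interp Fn} {ν μ : Val V}
    {x y : Tm Fn W .num → ℚ} (hx : P.Sat I ν x) (hy : P.Sat J μ y)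
    (he : (a.toArg P τ).eval I ν x = (b.toArg P τ).eval I ν x) :
    (a.toArg P τ).eval J μ y = (b.toArg P τ).eval J μ y := by
  cases s with
  | num => exact ((h a b ha hb).eq_iff hx).1 he J μ y hy
  | bool => exact he

/-- The symbolic values of the subterms of `A` are the values under an interpretation and a
valuation, provided that this holds for variables and applications. -/
theorem Sys.DecidesSubs.eval_eq {P : Sys (Tm Fn W .num) VS FS} {A : Tm Fn W .bool}
    (hA : P.DecidesSubs A) (τ : Tm Fn W .bool → Bool) {I : Interp Fn} {ν : Val V}
    {x : Tm Fn W .num → ℚ} (hx : P.Sat I ν x) {w : Val W}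
    (hvar : ∀ v ∈ A.vars, w v.1 v.2 = ((Tm.var v.2).toArg P τ).eval I ν x)
    (happ : ∀ (ds : List Ty) (s : Ty) (f : Fn ds s) (args : (i : Fin ds.length) → Tm Fn W (ds.get i)),
      ⟨s, .app f args⟩ ∈ A.subs →
      (∀ i, (args i).eval I w = ((args i).toArg P τ).eval I ν x) →
      (Tm.app f args).eval I w = ((Tm.app f args).toArg P τ).eval I ν x)
    {s : Ty} (t : Tm Fn W s) (ht : t.subs ⊆ A.subs) :
    t.eval I w = (t.toArg P τ).eval I ν x := by
  induction t with
  | @var s y => exact hvar ⟨s, y⟩ ((Tm.var_mem_subs_iff A ⟨s, y⟩).1 (ht (Tm.self_mem_subs _)))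
  | app f args ih =>
    exact happ _ _ f args (ht (Tm.self_mem_subs _)) fun i =>
      ih i (fun _ h => ht (Or.inr (Set.mem_iUnion_of_mem i h)))
  | const q =>
    simp only [Tm.eval, Tm.toArg, Tm.toAff, Arg.eval]
    rw [Aff.eval_of_coef_eq_zero (a := Aff.ofTm (STm.const q)) rfl]
    simp only [Aff.ofTm, STm.const, Tm.eval]
  | tt => rfl
  | ff => rfl
  | smul q a ih =>
    have ih := ih fun _ h => ht (Or.inr h)
    simp only [Tm.eval, ih]
    simp only [Tm.toArg, Tm.toAff, Arg.eval]
    rw [Aff.eval_addSMul, Aff.eval_of_coef_eq_zero (a := Aff.ofTm _) rfl]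
    exact (zero_add _).symm
  | add a b iha ihb =>
    have iha := iha fun _ h => ht (Or.inr (Or.inl h))
    have ihb := ihb fun _ h => ht (Or.inr (Or.inr h))
    simp only [Tm.eval, iha, ihb]
    simp only [Tm.toArg, Tm.toAff, Arg.eval]
    rw [Aff.eval_addSMul, one_mul]
  | not p ih =>
    have ih := ih fun _ h => ht (Or.inr h)
    simp only [Tm.eval, ih]
    simp only [Tm.toArg, Tm.toTruth, Arg.eval]
  | and p q iha ihb | or p q iha ihb =>
    have iha := iha fun _ h => ht (Or.inr (Or.inl h))
    have ihb := ihb fun _ h => ht (Or.inr (Or.inr h))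
    simp only [Tm.eval, iha, ihb]
    simp only [Tm.toArg, Tm.toTruth, Arg.eval]
  | @eq s a b iha ihb =>
    have hsa : a.subs ⊆ A.subs := fun _ h => ht (Or.inr (Or.inl h))
    have hsb : b.subs ⊆ A.subs := fun _ h => ht (Or.inr (Or.inr h))
    simp only [Tm.eval, iha hsa, ihb hsb]
    cases s with
    | num =>
      simp only [Tm.toArg, Tm.toTruth, Arg.eval]
      exact decide_eq_decide.2
        ((hA a b (hsa a.self_mem_subs) (hsb b.self_mem_subs)).eq_iff hx)
    | bool =>
      simp only [Tm.toArg, Tm.toTruth, Arg.eval]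
      exact decide_eq_decide.2 Iff.rfl
  | lt a b iha ihb =>
    have hsa : a.subs ⊆ A.subs := fun _ h => ht (Or.inr (Or.inl h))
    have hsb : b.subs ⊆ A.subs := fun _ h => ht (Or.inr (Or.inr h))
    simp only [Tm.eval, iha hsa, ihb hsb]
    simp only [Tm.toArg, Tm.toTruth, Arg.eval]
    exact decide_eq_decide.2
        ((hA a b (hsa a.self_mem_subs) (hsb b.self_mem_subs)).lt_iff hx)

/-- The application constraint of a term. -/
noncomputable def Tm.toApps (P : Sys (Tm Fn W .num) VS FS) (τ : Tm Fn W .bool → Bool) :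
    ((s : Ty) × Tm Fn W s) → List (App (Tm Fn W .num) VS FS)
  | ⟨s, .app (ds := ds) f args⟩ =>
      [⟨ds, s, f, fun i => (args i).toArg P τ, (Tm.app f args).toArg P τ⟩]
  | _ => []

theorem Tm.mem_toApps {P : Sys (Tm Fn W .num) VS FS} {τ : Tm Fn W .bool → Bool}
    {u : (s : Ty) × Tm Fn W s} {a : App (Tm Fn W .num) VS FS} (h : a ∈ Tm.toApps P τ u) :
    ∃ (args : (i : Fin a.ds.length) → Tm Fn W (a.ds.get i)), u = ⟨a.s, .app a.f args⟩ ∧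
      a.args = (fun i => (args i).toArg P τ) ∧ a.val = (Tm.app a.f args).toArg P τ := by
  obtain ⟨s, t⟩ := u
  cases t with
  | app f args =>
    simp only [Tm.toApps, List.mem_singleton] at h
    subst h
    exact ⟨args, rfl, rfl, rfl⟩
  | _ => simp [Tm.toApps] at h

theorem Tm.exists_apps (P : Sys (Tm Fn W .num) VS FS) (τ : Tm Fn W .bool → Bool) {s : Ty}
    (A : Tm Fn W s) : ∃ apps : List (App (Tm Fn W .num) VS FS),
      (∀ (ds : List Ty) (s : Ty) (f : Fn ds s) args, ⟨s, .app f args⟩ ∈ A.subs →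
        ⟨ds, s, f, fun i => (args i).toArg P τ, (Tm.app f args).toArg P τ⟩ ∈ apps) ∧
      ∀ a ∈ apps, ∃ (args : (i : Fin a.ds.length) → Tm Fn W (a.ds.get i)),
        ⟨a.s, .app a.f args⟩ ∈ A.subs ∧ a.args = (fun i => (args i).toArg P τ) ∧
          a.val = (Tm.app a.f args).toArg P τ := by
  refine ⟨A.finite_subs.toFinset.toList.flatMap (Tm.toApps P τ), fun ds s f args h => ?_,
    fun a ha => ?_⟩
  · exact List.mem_flatMap.2 ⟨_, Finset.mem_toList.2 (A.finite_subs.mem_toFinset.2 h),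
      List.mem_singleton.2 rfl⟩
  · obtain ⟨u, hu, ha⟩ := List.mem_flatMap.1 ha
    obtain ⟨args, rfl, h⟩ := Tm.mem_toApps ha
    exact ⟨args, A.finite_subs.mem_toFinset.1 (Finset.mem_toList.1 hu), h⟩

theorem Tm.subs_app_subset {s : Ty} {A : Tm Fn W s} {ds : List Ty} {r : Ty} {f : Fn ds r}
    {args : (i : Fin ds.length) → Tm Fn W (ds.get i)} (h : ⟨r, .app f args⟩ ∈ A.subs)
    (i : Fin ds.length) : (args i).subs ⊆ A.subs :=
  fun _ hu => A.subs_subset h (Or.inr (Set.mem_iUnion_of_mem i hu))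

/-- The value of a variable or application as an argument. -/
noncomputable def atomArg (VS : Set (AllVar V)) (FS : Set (AllFn Fn)) (τ : Tm Fn W .bool → Bool) :
    {s : Ty} → Tm Fn W s → Arg (Tm Fn W .num) VS FS s
  | .num, t => (⟨Finsupp.single t 1, STm.const 0⟩ : Aff (Tm Fn W .num) VS FS)
  | .bool, t => τ t

theorem toArg_var (P : Sys (Tm Fn W .num) VS FS) (τ : Tm Fn W .bool → Bool) {s : Ty} (x : W s) :
    (Tm.var x).toArg P τ = atomArg VS FS τ (Tm.var (Fn := Fn) x) := by
  cases s <;> simp [Tm.toArg, atomArg, Tm.toAff, Tm.toTruth]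

theorem toArg_app (P : Sys (Tm Fn W .num) VS FS) (τ : Tm Fn W .bool → Bool) {ds : List Ty} {s : Ty}
    (f : Fn ds s) (args : (i : Fin ds.length) → Tm Fn W (ds.get i)) :
    (Tm.app f args).toArg P τ = atomArg VS FS τ (Tm.app f args) := by
  cases s <;> simp [Tm.toArg, atomArg, Tm.toAff, Tm.toTruth]

theorem eval_atomArg {τ : Tm Fn W .bool → Bool} {A : Tm Fn W .bool} {I : Interp Fn} {w : Val W}
    (hτ : ∀ t : Tm Fn W .bool, ⟨.bool, t⟩ ∈ A.subs → τ t = t.eval I w) (ν : Val V) {s : Ty}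
    {t : Tm Fn W s} (ht : ⟨s, t⟩ ∈ A.subs) :
    (atomArg VS FS τ t).eval I ν (fun t => t.eval I w) = t.eval I w := by
  cases s with
  | num =>
    simp only [atomArg, Arg.eval, Aff.eval, STm.const, Tm.eval, Finsupp.linearCombination_single,
      one_smul]
    exact add_zero _
  | bool => exact hτ t ht

/-- The system that fixes the values of the shared variables. -/
theorem exists_sys_of_vars {K : Type} (l : List (AllVar V)) (hl : ∀ v ∈ l, v ∈ VS)
    (arg : (v : AllVar V) → Arg K VS FS v.1) :
    ∃ P : Sys K VS FS, ∀ I ν x, P.Sat I ν x ↔ ∀ v ∈ l, (arg v).eval I ν x = ν v.1 v.2 := by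
  induction l with
  | nil => exact ⟨⟨[], [], []⟩, fun I ν x => by simp [Sys.Sat]⟩
  | cons v l ih =>
    obtain ⟨P, hP⟩ := ih fun u hu => hl u (List.mem_cons_of_mem _ hu)
    obtain ⟨P', hP'⟩ := P.exists_add_eq (arg v) ⟨.var v.2,
      Set.singleton_subset_iff.2 (hl v List.mem_cons_self), Set.empty_subset _⟩
    refine ⟨P', fun I ν x => ?_⟩
    rw [hP', hP, List.forall_mem_cons, and_comm]
    rfl

end Interpolation

/-! ### Craig interpolation for an existential formula. -/

section Interpolation

variable {Fn : List Ty → Ty → Type} {V Y : Ty → Type} {VS VB : Set (AllVar V)}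
  {FS FB : Set (AllFn Fn)}

/-- The valuations `ν` and `μ` as one valuation. -/
def Val.append (ν : Val V) (μ : Val Y) : Val (Ext V Y) := fun s => Sum.elim (ν s) (μ s)

/-- The truth values `τ` and the numbers `x` are the values of the subterms of `A` in a model of
`A` that extends `ν`. -/
def IsModelValue (A : QF Fn (Ext V Y)) (τ : Tm Fn (Ext V Y) .bool → Bool) (I : Interp Fn)
    (ν : Val V) (x : Tm Fn (Ext V Y) .num → ℚ) : Prop :=
  ∃ μ : Val Y, A.eval I (ν.append μ) = true ∧
    (∀ t : Tm Fn (Ext V Y) .bool, ⟨.bool, t⟩ ∈ A.subs → τ t = t.eval I (ν.append μ)) ∧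
    x = fun t => t.eval I (ν.append μ)

theorem Sys.DecidesSubs.exists_val {A : QF Fn (Ext V Y)} {P : Sys (Tm Fn (Ext V Y) .num) VS FS}
    (hP : P.DecidesSubs A) {τ : Tm Fn (Ext V Y) .bool → Bool} {I : Interp Fn}
    {ν : Val V} {x : Tm Fn (Ext V Y) .num → ℚ} (hx : P.Sat I ν x)
    (hQ : IsModelValue A τ I ν x) :
    ∃ w : Val (Ext V Y), A.eval I w = true ∧
      ∀ {s : Ty} (t : Tm Fn (Ext V Y) s), t.subs ⊆ A.subs →
        t.eval I w = (t.toArg P τ).eval I ν x := by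
  obtain ⟨μ, hμ, hτ, rfl⟩ := hQ
  refine ⟨_, hμ, hP.eval_eq τ hx (fun v hv => ?_) fun ds s f args hf _ => ?_⟩
  · rw [toArg_var, eval_atomArg hτ ν ((Tm.var_mem_subs_iff A v).2 hv)]
    rfl
  · rw [toArg_app, eval_atomArg hτ ν hf]

/-- A single actual model would already force consistency in all solutions, since functions respect
equality and equalities between subterms do not depend on the solution. So an inconsistent case has
no models. -/
theorem Sys.DecidesSubs.separable_of_not_cong {A : QF Fn (Ext V Y)}
    {B : Interp Fn → Val V → Prop} {P : Sys (Tm Fn (Ext V Y) .num) VS FS}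
    (hP : P.DecidesSubs A) {τ : Tm Fn (Ext V Y) .bool → Bool}
    {apps : List (App (Tm Fn (Ext V Y) .num) VS FS)}
    (happs : ∀ a ∈ apps, ∃ (args : (i : Fin a.ds.length) → Tm Fn (Ext V Y) (a.ds.get i)),
        ⟨a.s, .app a.f args⟩ ∈ A.subs ∧ a.args = (fun i => (args i).toArg P τ) ∧
          a.val = (Tm.app a.f args).toArg P τ)
    (hcong : ¬ P.Cong apps) :
    Separable VS FS (fun I ν => ∃ x, P.Sat I ν x ∧ IsModelValue A τ I ν x) B := by
  refine separable_of_forall_not ?_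
  rintro I ν ⟨x, hx, hQ⟩
  obtain ⟨w, hw, hr⟩ := hP.exists_val hx hQ
  refine hcong fun ds s f args args' val val' hm hm' J ν' y hy hargs => ?_
  obtain ⟨t, ht, hta, htv⟩ := happs _ hm
  obtain ⟨t', ht', hta', htv'⟩ := happs _ hm'
  dsimp only at t ht hta htv t' ht' hta' htv'
  subst hta htv hta' htv'
  refine hP.toArg_eq τ ht ht' hx hy ?_
  -- At `x` symbolic values are actual values. The equality of arguments assumed at `y` is
  -- transported to `x`, where equal arguments give equal applications; the preceding `toArg_eq`
  -- carries that back to `y`.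
  rw [← hr _ (A.subs_subset ht), ← hr _ (A.subs_subset ht')]
  simp only [Tm.eval]
  congr 1
  funext i
  rw [hr _ (Tm.subs_app_subset ht i), hr _ (Tm.subs_app_subset ht' i)]
  exact hP.toArg_eq τ (Tm.subs_app_subset ht i (Tm.self_mem_subs _))
    (Tm.subs_app_subset ht' i (Tm.self_mem_subs _)) hy hx (hargs i)

-- A solution of `P` that meets all application constraints yields a true model of `A`, by reading
-- the variables off the solution. This supplies the disjointness required by `separable_of_sys`.
-- Cases where `A` is symbolically false or the constraints are inconsistent contain no models.
open Classical in
theorem Sys.DecidesSubs.separable {A : QF Fn (Ext V Y)}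
    {B : Interp Fn → Val V → Prop} {P : Sys (Tm Fn (Ext V Y) .num) VS FS}
    (hP : P.DecidesSubs A) {τ : Tm Fn (Ext V Y) .bool → Bool} (hB : FinDep VB FB B)
    (hVS : ∀ v ∈ VB, ⟨v.1, Sum.inl v.2⟩ ∈ A.vars → v ∈ VS)
    (hFS : FS ⊆ FB) (hFS' : ∀ f ∈ FB, f ∈ A.fns → f ∈ FS)
    (hshared : ∀ I ν x, P.Sat I ν x → ∀ v ∈ VS,
      (atomArg VS FS τ (Tm.var (Sum.inl v.2) : Tm Fn (Ext V Y) v.1)).eval I ν x = ν v.1 v.2)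
    (h : ∀ (I : Interp Fn) (ν : Val V) (μ : Val Y), A.eval I (ν.append μ) = true → ¬ B I ν) :
    Separable VS FS (fun I ν => ∃ x, P.Sat I ν x ∧ IsModelValue A τ I ν x) B := by
  by_cases hAt : A.toTruth P τ = true
  swap
  · refine separable_of_forall_not ?_
    rintro I ν ⟨x, hx, hQ⟩
    obtain ⟨w, hw, hr⟩ := hP.exists_val hx hQ
    exact hAt ((hr A subset_rfl).symm.trans hw)
  obtain ⟨apps, happs₁, happs₂⟩ := A.exists_apps P τ
  by_cases hcong : P.Cong apps
  swap
  · exact hP.separable_of_not_cong happs₂ hcong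
  refine (separable_of_sys (VB := VB) (FB := FB) hFS hB _ _ P apps rfl rfl
    (fun a ha hf => ?_) hcong fun I ν x hx hap hBI => ?_).mono ?_
  · obtain ⟨t, ht, -⟩ := happs₂ a ha
    exact hFS' _ hf (A.fn_mem_fns_of_mem_subs a.f t ht)
  · let ν' : Val V := fun s v => if (⟨s, Sum.inl v⟩ : AllVar (Ext V Y)) ∈ A.vars then
      ((Tm.var (Sum.inl v) : Tm Fn (Ext V Y) s).toArg P τ).eval I ν x else ν s v
    let μ : Val Y := fun s y => ((Tm.var (Sum.inr y) : Tm Fn (Ext V Y) s).toArg P τ).eval I ν x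
    have hνν' : AgreeVar VB ν ν' := by
      rintro ⟨s, v⟩ hv
      by_cases hvA : (⟨s, Sum.inl v⟩ : AllVar (Ext V Y)) ∈ A.vars
      · simp only [ν', if_pos hvA, toArg_var]
        exact (hshared I ν x hx ⟨s, v⟩ (hVS _ hv hvA)).symm
      · simp only [ν', if_neg hvA]
    obtain ⟨E, -, hE⟩ := hB I ν hBI
    refine h I ν' μ ?_ (hE I ν' (fun _ _ _ _ _ _ => rfl) hνν')
    rw [hP.eval_eq τ hx ?_ ?_ A subset_rfl]
    · exact hAt
    · rintro ⟨s, v | y⟩ hv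
      · simp only [Val.append, Sum.elim_inl, ν', if_pos hv]
      · rfl
    · intro ds s f args hf hargs
      simp only [Tm.eval, hargs]
      exact hap _ (happs₁ ds s f args hf)
  · rintro I ν ⟨x, hx, hQ⟩
    obtain ⟨w, hw, hr⟩ := hP.exists_val hx hQ
    refine ⟨x, hx, fun a ha => ?_⟩
    obtain ⟨t, ht, hargs, hval⟩ := happs₂ a ha
    simp only [App.Holds, hargs, hval, ← hr _ (A.subs_subset ht)]
    simp only [← hr _ (Tm.subs_app_subset ht _), Tm.eval]

/-- Craig interpolation: an existential formula `∃ Y, A` and a disjoint set of models that depends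
only on the variables in `VB` and on the symbols in `FB` are separated by a quantifier-free formula
over the common variables and symbols. -/
theorem separable_of_disjoint (A : QF Fn (Ext V Y)) {B : Interp Fn → Val V → Prop}
    (hB : FinDep VB FB B)
    (h : ∀ (I : Interp Fn) (ν : Val V) (μ : Val Y), A.eval I (ν.append μ) = true → ¬ B I ν) :
    Separable ({v | ⟨v.1, Sum.inl v.2⟩ ∈ A.vars} ∩ VB) (A.fns ∩ FB)
      (fun I ν => ∃ μ : Val Y, A.eval I (ν.append μ) = true) B := by
  classical
  obtain ⟨VS, hVS⟩ : ∃ VS : Set (AllVar V), VS = {v | ⟨v.1, Sum.inl v.2⟩ ∈ A.vars} ∩ VB :=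
    ⟨_, rfl⟩
  obtain ⟨FS, hFS⟩ : ∃ FS : Set (AllFn Fn), FS = A.fns ∩ FB := ⟨_, rfl⟩
  rw [← hVS, ← hFS]
  have hfin : ∀ s : Ty, {t : Tm Fn (Ext V Y) s | ⟨s, t⟩ ∈ A.subs}.Finite := fun s =>
    A.finite_subs.preimage fun a _ b _ h => by simpa using h
  have hVSfin : VS.Finite := by
    refine (A.finite_subs.preimage (f := fun v : AllVar V =>
      (⟨v.1, .var (Sum.inl v.2)⟩ : (s : Ty) × Tm Fn (Ext V Y) s)) ?_).subset
        fun v hv => (Tm.var_mem_subs_iff A ⟨v.1, Sum.inl v.2⟩).2 (hVS.subset hv).1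
    rintro ⟨s, a⟩ _ ⟨s', b⟩ _ h
    simp only [Sigma.mk.injEq] at h
    obtain ⟨rfl, h⟩ := h
    simpa using h
  suffices key : ∀ τ : Tm Fn (Ext V Y) .bool → Bool,
      Separable VS FS (fun I ν => ∃ x, IsModelValue A τ I ν x) B by
    -- Only the values of `τ` on the finitely many Boolean subterms matter, so the guesses range
    -- over the subsets `S` of true ones.
    refine (separable_biUnion (hfin .bool).toFinset.powerset
      (A := fun S I ν => ∃ x, IsModelValue A (fun t => decide (t ∈ S)) I ν x)
      fun S _ => key _).mono ?_
    rintro I ν ⟨μ, hμ⟩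
    refine ⟨(hfin .bool).toFinset.filter fun t => t.eval I (ν.append μ) = true,
      Finset.mem_powerset.2 (Finset.filter_subset _ _), _, μ, hμ, fun t ht => ?_, rfl⟩
    have : t ∈ (hfin .bool).toFinset := (hfin .bool).mem_toFinset.2 ht
    simp only [Finset.mem_filter, this, true_and]
    generalize t.eval I (ν.append μ) = b
    revert b
    exact fun b => by cases b <;> rfl
  intro τ
  obtain ⟨P₀, hP₀⟩ := exists_sys_of_vars (VS := VS) (FS := FS) hVSfin.toFinset.toList
    (fun v hv => hVSfin.mem_toFinset.1 (Finset.mem_toList.1 hv))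
    (fun v => atomArg VS FS τ (Tm.var (Sum.inl v.2) : Tm Fn (Ext V Y) v.1))
  have hreal₀ : ∀ I ν x, IsModelValue A τ I ν x → P₀.Sat I ν x := by
    rintro I ν _ ⟨μ, -, hτ, rfl⟩
    refine (hP₀ _ _ _).2 fun v hv => ?_
    have hv := hVSfin.mem_toFinset.1 (Finset.mem_toList.1 hv)
    rw [hVS] at hv
    exact eval_atomArg hτ ν ((Tm.var_mem_subs_iff A ⟨v.1, Sum.inl v.2⟩).2 hv.1)
  let N := (hfin .num).toFinset.toList
  refine (separable_of_decides (IsModelValue A τ)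
    ((N ×ˢ N).map fun d => (d.1.toAff VS FS, d.2.toAff VS FS)) P₀ ?_).mono ?_
  swap
  · rintro I ν ⟨x, hx⟩
    exact ⟨x, hreal₀ I ν x hx, hx⟩
  intro P hPP₀ hdec
  have hP : P.DecidesSubs A := by
    intro a b ha hb
    have hmem : (a, b) ∈ N ×ˢ N := List.mem_product.2
      ⟨Finset.mem_toList.2 ((hfin .num).mem_toFinset.2 ha),
        Finset.mem_toList.2 ((hfin .num).mem_toFinset.2 hb)⟩
    exact hdec (a.toAff VS FS, b.toAff VS FS) (List.mem_map_of_mem hmem)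
  exact hP.separable hB (fun v hv hvA => hVS.superset ⟨hvA, hv⟩)
    (hFS.subset.trans Set.inter_subset_right) (fun f hf hfA => hFS.superset ⟨hfA, hf⟩)
    (fun I ν x hx v hv => (hP₀ I ν x).1 (hPP₀ I ν x hx) v
      (Finset.mem_toList.2 (hVSfin.mem_toFinset.2 hv))) h

end Interpolation

/-! ### Existential formulae and construction of inductive interpolants. -/

section Formulae

variable {Fn : List Ty → Ty → Type} {V W : Ty → Type}

theorem FO.holds_subst (I : Interp Fn) (φ : FO Fn V) :
    ∀ {W : Ty → Type} (σ : (s : Ty) → V s → Tm Fn W s) (ν : Val W),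
      (φ.subst σ).Holds I ν ↔ φ.Holds I (fun s x => (σ s x).eval I ν) := by
  induction φ with
  | qf p => intro W σ ν; simp only [FO.subst, FO.Holds, Tm.eval_subst]
  | neg φ ih => intro W σ ν; simp only [FO.subst, FO.Holds, ih]
  | and φ ψ ih ih' => intro W σ ν; simp only [FO.subst, FO.Holds, ih, ih']
  | or φ ψ ih ih' => intro W σ ν; simp only [FO.subst, FO.Holds, ih, ih']
  | ex Y hY φ ih =>
    intro W σ ν
    simp only [FO.subst, FO.Holds, ih]
    refine exists_congr fun μ => iff_of_eq (congrArg _ ?_)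
    funext s z
    cases z with
    | inl x => simp only [Sum.elim_inl, Tm.eval_rename]
    | inr y => simp only [Sum.elim_inr, Tm.eval]
  | all Y hY φ ih =>
    intro W σ ν
    simp only [FO.subst, FO.Holds, ih]
    refine forall_congr' fun μ => iff_of_eq (congrArg _ ?_)
    funext s z
    cases z with
    | inl x => simp only [Sum.elim_inl, Tm.eval_rename]
    | inr y => simp only [Sum.elim_inr, Tm.eval]

theorem FO.holds_rename (I : Interp Fn) (φ : FO Fn V) (r : (s : Ty) → V s → W s) (ν : Val W) :
    (φ.rename r).Holds I ν ↔ φ.Holds I (fun s x => ν s (r s x)) :=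
  FO.holds_subst I φ _ ν

theorem FO.mem_vars_subst (φ : FO Fn V) :
    ∀ {W : Ty → Type} (σ : (s : Ty) → V s → Tm Fn W s) {w : AllVar W},
      w ∈ (φ.subst σ).vars → ∃ v ∈ φ.vars, w ∈ (σ v.1 v.2).vars := by
  induction φ with
  | qf p => exact fun σ _ h => Tm.mem_vars_subst σ p h
  | neg φ ih => exact fun σ _ h => ih σ h
  | and φ ψ ih ih' | or φ ψ ih ih' =>
    rintro W σ w (h | h)
    · obtain ⟨v, hv, h⟩ := ih σ h
      exact ⟨v, Or.inl hv, h⟩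
    · obtain ⟨v, hv, h⟩ := ih' σ h
      exact ⟨v, Or.inr hv, h⟩
  | ex Y hY φ ih | all Y hY φ ih =>
    intro W σ w h
    obtain ⟨⟨s, v | y⟩, hv, h⟩ := ih _ h
    · obtain ⟨u, hu, h⟩ := Tm.mem_vars_rename _ _ h
      refine ⟨⟨s, v⟩, hv, ?_⟩
      obtain ⟨t, u⟩ := u
      obtain ⟨s', w⟩ := w
      cases h
      exact hu
    · cases h

theorem FO.mem_vars_rename (φ : FO Fn V) (r : (s : Ty) → V s → W s) {w : AllVar W}
    (h : w ∈ (φ.rename r).vars) : ∃ v ∈ φ.vars, w = ⟨v.1, r v.1 v.2⟩ :=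
  FO.mem_vars_subst φ _ h

/-- Formulae built from quantifier-free formulae by conjunction, disjunction and existential
quantification. -/
def FO.IsEx : {V : Ty → Type} → FO Fn V → Prop
  | _, .qf _ => True
  | _, .neg _ => False
  | _, .and φ ψ => φ.IsEx ∧ ψ.IsEx
  | _, .or φ ψ => φ.IsEx ∧ ψ.IsEx
  | _, .ex _ _ φ => φ.IsEx
  | _, .all _ _ _ => False

theorem FO.IsEx.subst {φ : FO Fn V} (h : φ.IsEx) :
    ∀ {W : Ty → Type} (σ : (s : Ty) → V s → Tm Fn W s), (φ.subst σ).IsEx := by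
  induction φ with
  | qf p => exact fun _ => trivial
  | neg | all => exact h.elim
  | and φ ψ ih ih' | or φ ψ ih ih' => exact fun σ => ⟨ih h.1 σ, ih' h.2 σ⟩
  | ex Y hY φ ih => exact fun σ => ih h _

theorem FO.isEx_conj (L : List (FO Fn V)) (h : ∀ φ ∈ L, φ.IsEx) : (FO.conj L).IsEx := by
  induction L with
  | nil => trivial
  | cons φ L ih =>
    exact ⟨h φ List.mem_cons_self, ih fun ψ hψ => h ψ (List.mem_cons_of_mem _ hψ)⟩

theorem FO.holds_conj (I : Interp Fn) (ν : Val V) (L : List (FO Fn V)) :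
    (FO.conj L).Holds I ν ↔ ∀ φ ∈ L, φ.Holds I ν := by
  induction L with
  | nil => simp [FO.conj, FO.Holds, Tm.eval]
  | cons φ L ih => simp [FO.conj, FO.Holds, ih]

/-- The renaming that skips the second of two blocks of variables. -/
def Ext.left (V Y Z : Ty → Type) (s : Ty) : Ext V Y s → Ext V (Ext Y Z) s :=
  Sum.map id Sum.inl

/-- The renaming that skips the first of two blocks of variables. -/
def Ext.right (V Y Z : Ty → Type) (s : Ty) : Ext V Z s → Ext V (Ext Y Z) s :=
  Sum.map id Sum.inr

theorem Tm.eval_left {Y Z : Ty → Type} (I : Interp Fn) (ν : Val V) (μ : Val (Ext Y Z)) {s : Ty}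
    (t : Tm Fn (Ext V Y) s) : (t.rename (Ext.left V Y Z)).eval I (ν.append μ) =
      t.eval I (ν.append fun s y => μ s (Sum.inl y)) := by
  rw [Tm.eval_rename]
  congr 1
  funext s z
  cases z <;> rfl

theorem Tm.eval_right {Y Z : Ty → Type} (I : Interp Fn) (ν : Val V) (μ : Val (Ext Y Z)) {s : Ty}
    (t : Tm Fn (Ext V Z) s) : (t.rename (Ext.right V Y Z)).eval I (ν.append μ) =
      t.eval I (ν.append fun s z => μ s (Sum.inr z)) := by
  rw [Tm.eval_rename]
  congr 1
  funext s z
  cases z <;> rfl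

theorem Tm.inl_mem_vars_left {Y Z : Ty → Type} {s : Ty} {t : Tm Fn (Ext V Y) s} {v : AllVar V}
    (h : ⟨v.1, Sum.inl v.2⟩ ∈ (t.rename (Ext.left V Y Z)).vars) :
    ⟨v.1, Sum.inl v.2⟩ ∈ t.vars := by
  obtain ⟨v, v'⟩ := v
  obtain ⟨⟨s, u | y⟩, hu, h⟩ := Tm.mem_vars_rename _ _ h
  · cases h; exact hu
  · cases h

theorem Tm.inl_mem_vars_right {Y Z : Ty → Type} {s : Ty} {t : Tm Fn (Ext V Z) s} {v : AllVar V}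
    (h : ⟨v.1, Sum.inl v.2⟩ ∈ (t.rename (Ext.right V Y Z)).vars) :
    ⟨v.1, Sum.inl v.2⟩ ∈ t.vars := by
  obtain ⟨v, v'⟩ := v
  obtain ⟨⟨s, u | y⟩, hu, h⟩ := Tm.mem_vars_rename _ _ h
  · cases h; exact hu
  · cases h

/-- Prenex form of an existential formula. -/
theorem FO.IsEx.exists_prenex {φ : FO Fn V} (h : φ.IsEx) :
    ∃ (Y : Ty → Type) (p : QF Fn (Ext V Y)),
      (∀ I ν, φ.Holds I ν ↔ ∃ μ : Val Y, p.eval I (ν.append μ) = true) ∧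
      (∀ v : AllVar V, ⟨v.1, Sum.inl v.2⟩ ∈ p.vars → v ∈ φ.vars) ∧ p.fns ⊆ φ.fns := by
  induction φ with
  | neg | all => exact h.elim
  | @qf V p =>
    refine ⟨fun _ => Empty, p.rename fun _ => Sum.inl, fun I ν => ?_, fun v hv => ?_, ?_⟩
    · simp only [Tm.eval_rename]
      exact ⟨fun h => ⟨fun _ => Empty.elim, h⟩, fun ⟨_, h⟩ => h⟩
    · obtain ⟨v, v'⟩ := v
      obtain ⟨u, hu, h⟩ := Tm.mem_vars_rename _ _ hv
      cases h
      exact hu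
    · rw [Tm.fns_rename]; exact subset_rfl
  | @and V φ ψ ih ih' =>
    obtain ⟨Y, p, hp, hpv, hpf⟩ := ih h.1
    obtain ⟨Z, q, hq, hqv, hqf⟩ := ih' h.2
    refine ⟨Ext Y Z, .and (p.rename (Ext.left V Y Z)) (q.rename (Ext.right V Y Z)),
      fun I ν => ?_, fun v hv => ?_, ?_⟩
    · simp only [FO.Holds, hp, hq, Tm.eval, Bool.and_eq_true, Tm.eval_left, Tm.eval_right]
      exact ⟨fun ⟨⟨μ, h⟩, ⟨μ', h'⟩⟩ => ⟨μ.append μ', h, h'⟩, fun ⟨μ, h, h'⟩ => ⟨⟨_, h⟩, ⟨_, h'⟩⟩⟩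
    · exact hv.imp (fun h => hpv v (Tm.inl_mem_vars_left h))
        fun h => hqv v (Tm.inl_mem_vars_right h)
    · simp only [Tm.fns, Tm.fns_rename]
      exact Set.union_subset_union hpf hqf
  | @or V φ ψ ih ih' =>
    obtain ⟨Y, p, hp, hpv, hpf⟩ := ih h.1
    obtain ⟨Z, q, hq, hqv, hqf⟩ := ih' h.2
    refine ⟨Ext Y Z, .or (p.rename (Ext.left V Y Z)) (q.rename (Ext.right V Y Z)),
      fun I ν => ?_, fun v hv => ?_, ?_⟩
    -- The block of the false disjunct needs some values; both domains are inhabited.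
    · have d : {X : Ty → Type} → Val X := fun s _ => match s with
        | .num => (0 : ℚ)
        | .bool => false
      simp only [FO.Holds, hp, hq, Tm.eval, Bool.or_eq_true, Tm.eval_left, Tm.eval_right]
      constructor
      · rintro (⟨μ, h⟩ | ⟨μ, h⟩)
        · exact ⟨Val.append μ d, Or.inl h⟩
        · exact ⟨Val.append d μ, Or.inr h⟩
      · rintro ⟨μ, h | h⟩
        · exact Or.inl ⟨_, h⟩
        · exact Or.inr ⟨_, h⟩
    · exact hv.imp (fun h => hpv v (Tm.inl_mem_vars_left h))
        fun h => hqv v (Tm.inl_mem_vars_right h)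
    · simp only [Tm.fns, Tm.fns_rename]
      exact Set.union_subset_union hpf hqf
  | @ex V Y hY φ ih =>
    obtain ⟨Z, p, hp, hpv, hpf⟩ := ih h
    let r : (s : Ty) → Ext (Ext V Y) Z s → Ext V (Ext Y Z) s := fun s => Equiv.sumAssoc _ _ _
    refine ⟨Ext Y Z, p.rename r, fun I ν => ?_, fun v hv => ?_, ?_⟩
    · have key : ∀ μ : Val (Ext Y Z), (p.rename r).eval I (ν.append μ) =
          p.eval I (Val.append (ν.append fun s y => μ s (Sum.inl y))
            fun s z => μ s (Sum.inr z)) := by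
        intro μ
        rw [Tm.eval_rename]
        congr 1
        funext s z
        rcases z with (z | z) | z <;> rfl
      simp only [FO.Holds, hp, key]
      exact ⟨fun ⟨μ, μ', h⟩ => ⟨μ.append μ', h⟩, fun ⟨μ, h⟩ => ⟨_, _, h⟩⟩
    · obtain ⟨v, v'⟩ := v
      obtain ⟨⟨s, (u | y) | z⟩, hu, h⟩ := Tm.mem_vars_rename _ _ hv
      · cases h; exact hpv _ hu
      · cases h
      · cases h
    · rw [Tm.fns_rename]; exact hpf

/-- Once witnesses for the quantifiers are fixed, a quantifier-free formula remains, and its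
evaluation reads finitely many function values. The same witnesses serve every model that agrees
there. -/
theorem FO.IsEx.finDep {φ : FO Fn V} (h : φ.IsEx) :
    FinDep φ.vars φ.fns (fun I ν => φ.Holds I ν) := by
  intro I ν hφ
  obtain ⟨Y, p, hp, hpv, hpf⟩ := h.exists_prenex
  obtain ⟨μ, hμ⟩ := (hp I ν).1 hφ
  obtain ⟨E, hE, hfin⟩ := p.exists_finite_support I (ν.append μ)
  refine ⟨E, hE, fun J ν' hJ hν => (hp J ν').2 ⟨μ, ?_⟩⟩
  rw [hfin J (ν'.append μ) (hJ.mono hpf subset_rfl), hμ]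
  rintro ⟨s, v | y⟩ hv
  · exact hν ⟨s, v⟩ (hpv ⟨s, v⟩ hv)
  · rfl

theorem FinDep.forall {ι : Type*} [Finite ι] {VB : ι → Set (AllVar V)} {FB : ι → Set (AllFn Fn)}
    {B : ι → Interp Fn → Val V → Prop} (h : ∀ i, FinDep (VB i) (FB i) (B i)) :
    FinDep (⋃ i, VB i) (⋃ i, FB i) (fun I ν => ∀ i, B i I ν) := by
  intro I ν hB
  choose E hE h using fun i => h i I ν (hB i)
  exact ⟨⋃ i, E i, Set.finite_iUnion hE, fun J ν' hJ hν i =>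
    h i J ν' (hJ.mono (Set.subset_iUnion _ i) (Set.subset_iUnion _ i))
      (hν.mono (Set.subset_iUnion _ i))⟩

/-- A prefix interpolant `l` of the first `k` formulae of `Θ`. -/
structure IsPrefixInterpolant (Θ : List (FO Fn V)) (k : ℕ) (l : QF Fn V) : Prop where
  vars_subset : ∀ hk : k < Θ.length, l.vars ⊆ Θ[k].vars
  fns_subset : l.fns ⊆ ⋃ j : Fin Θ.length, ⋃ _ : j.val < k, (Θ.get j).fns
  disjoint : ∀ I ν, l.eval I ν = true → ¬ ∀ j : Fin Θ.length, k ≤ j.val → (Θ.get j).Holds I ν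

/-- Interpolation between `l ∧ Θ[k]` and the conjunction of the later entries. By the invariant on
`l`, common variables occur in `Θ[k]` and in some later entry; `hloc` then places them in `Θ[k +
1]`. Function symbols need no such locality, as they may come from any entry on either side. -/
theorem IsPrefixInterpolant.exists_succ {Θ : List (FO Fn V)} (hex : ∀ θ ∈ Θ, θ.IsEx)
    (hloc : ∀ (i j : ℕ) (hij : i < j) (hj : j < Θ.length),
      Θ[i].vars ∩ Θ[j].vars ⊆ Θ[i + 1].vars)
    {k : ℕ} {l : QF Fn V} (hk : k < Θ.length) (h : IsPrefixInterpolant Θ k l) :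
    ∃ l' : QF Fn V, IsPrefixInterpolant Θ (k + 1) l' ∧
      FO.Entails (.and (.qf l) Θ[k]) (.qf l') ∧
      (k + 1 < Θ.length → l'.vars ⊆ Θ[k].vars ∧
        l'.fns ⊆ ⋃ j : Fin Θ.length, ⋃ _ : k < j.val, (Θ.get j).fns) ∧
      (k + 1 = Θ.length → l' = .ff) := by
  rcases (Nat.succ_le_of_lt hk).eq_or_lt with hk1 | hk1
  -- After the last entry the interpolant must be `.ff` itself, not just an unsatisfiable formula,
  -- so this case bypasses interpolation.
  · refine ⟨.ff, ⟨fun h => absurd hk1 h.ne, by simp [Tm.fns], fun I ν h => by cases h⟩, ?_,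
      fun h => absurd hk1 h.ne, fun _ => rfl⟩
    rintro I ν ⟨hl, hθ⟩
    refine absurd (fun j hj => ?_) (h.disjoint I ν hl)
    have : j = ⟨k, hk⟩ := Fin.ext (by have := j.2; simp only; omega)
    subst this
    exact hθ
  · obtain ⟨Y, p, hp, hpv, hpf⟩ := (hex _ (List.getElem_mem hk)).exists_prenex
    let A : QF Fn (Ext V Y) := .and (l.rename fun _ => Sum.inl) p
    have hA : ∀ I ν (μ : Val Y), A.eval I (ν.append μ) = true ↔
        l.eval I ν = true ∧ p.eval I (ν.append μ) = true := by
      intro I ν μ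
      simp only [A, Tm.eval, Bool.and_eq_true, Tm.eval_rename]
      rfl
    have hAv : ∀ v : AllVar V, ⟨v.1, Sum.inl v.2⟩ ∈ A.vars → v ∈ Θ[k].vars := by
      rintro ⟨s, v⟩ (hv | hv)
      · obtain ⟨u, hu, he⟩ := Tm.mem_vars_rename _ _ hv
        cases he
        exact h.vars_subset hk hu
      · exact hpv _ hv
    have hAf : A.fns ⊆ l.fns ∪ Θ[k].fns := by
      simp only [A, Tm.fns, Tm.fns_rename]
      exact Set.union_subset_union subset_rfl hpf
    -- The later entries need not be merged into one formula: finite dependence passes to finite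
    -- conjunctions, with the union of the vocabularies.
    have hB := FinDep.forall fun j : {j : Fin Θ.length // k < j.val} =>
      (hex _ (Θ.get_mem j.1)).finDep
    obtain ⟨⟨q, hqv, hqf⟩, hq, hq'⟩ := separable_of_disjoint A hB (by
      intro I ν μ hAμ hB
      rw [hA] at hAμ
      refine h.disjoint I ν hAμ.1 fun j hj => ?_
      rcases hj.eq_or_lt with hj | hj
      · have : j = ⟨k, hk⟩ := Fin.ext hj.symm
        subst this
        exact (hp I ν).2 ⟨μ, hAμ.2⟩
      · exact hB ⟨j, hj⟩)
    refine ⟨q, ⟨fun _ v hv => ?_, fun f hf => ?_, fun I ν hqI hall => ?_⟩, ?_, fun _ => ⟨?_, ?_⟩,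
      fun h => absurd h hk1.ne⟩
    · obtain ⟨hvA, hvB⟩ := hqv hv
      obtain ⟨⟨j, hj⟩, hvj⟩ := Set.mem_iUnion.1 hvB
      exact hloc k j hj j.2 ⟨hAv v hvA, hvj⟩
    · rcases hAf (hqf hf).1 with hf | hf
      · obtain ⟨j, hj⟩ := Set.mem_iUnion.1 (h.fns_subset hf)
        obtain ⟨hjk, hj⟩ := Set.mem_iUnion.1 hj
        exact Set.mem_iUnion.2 ⟨j, Set.mem_iUnion.2 ⟨by omega, hj⟩⟩
      · exact Set.mem_iUnion.2 ⟨⟨k, hk⟩, Set.mem_iUnion.2 ⟨k.lt_succ_self, hf⟩⟩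
    · exact hq' I ν hqI fun j => hall j.1 j.2
    · rintro I ν ⟨hl, hθ⟩
      obtain ⟨μ, hμ⟩ := (hp I ν).1 hθ
      exact hq I ν ⟨μ, (hA I ν μ).2 ⟨hl, hμ⟩⟩
    · exact fun v hv => hAv v (hqv hv).1
    · intro f hf
      obtain ⟨⟨j, hj⟩, hfj⟩ := Set.mem_iUnion.1 (hqf hf).2
      exact Set.mem_iUnion.2 ⟨j, Set.mem_iUnion.2 ⟨hj, hfj⟩⟩

/-- An unsatisfiable sequence of existential formulae in which every formula shares variables with
its successor only has an inductive interpolant. -/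
theorem exists_isInductiveInterpolant {Θ : List (FO Fn V)} (hne : Θ ≠ [])
    (hex : ∀ θ ∈ Θ, θ.IsEx)
    (hloc : ∀ (i j : ℕ) (hij : i < j) (hj : j < Θ.length),
      Θ[i].vars ∩ Θ[j].vars ⊆ Θ[i + 1].vars)
    (hunsat : ∀ I ν, ¬ ∀ θ ∈ Θ, θ.Holds I ν) : ∃ Λ, IsInductiveInterpolant Θ Λ := by
  classical
  choose next hnext using fun (k : ℕ) (l : QF Fn V)
    (h : k < Θ.length ∧ IsPrefixInterpolant Θ k l) => h.2.exists_succ hex hloc h.1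
  let Λ : ℕ → QF Fn V := fun k => Nat.rec .tt (fun k l =>
    if h : k < Θ.length ∧ IsPrefixInterpolant Θ k l then next k l h else .ff) k
  have hsucc : ∀ (k : ℕ) (h : k < Θ.length ∧ IsPrefixInterpolant Θ k (Λ k)),
      Λ (k + 1) = next k (Λ k) h := fun k h => dif_pos h
  have hΛ : ∀ k ≤ Θ.length, IsPrefixInterpolant Θ k (Λ k) := by
    intro k
    induction k with
    | zero =>
      refine fun _ => ⟨fun _ => Set.empty_subset _, Set.empty_subset _, fun I ν _ h => ?_⟩
      refine hunsat I ν fun θ hθ => ?_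
      obtain ⟨j, rfl⟩ := List.mem_iff_get.1 hθ
      exact h j (Nat.zero_le _)
    | succ k ih =>
      intro hk
      have h : k < Θ.length ∧ IsPrefixInterpolant Θ k (Λ k) := ⟨hk, ih (Nat.le_of_succ_le hk)⟩
      rw [hsucc k h]
      exact (hnext k (Λ k) h).1
  have hstep := fun (k : ℕ) (hk : k < Θ.length) => hnext k (Λ k) ⟨hk, hΛ k hk.le⟩
  refine ⟨fun i => Λ i.val, rfl, ?_, fun i => ?_, fun i hi => ?_, fun i hi => ?_⟩
  · obtain ⟨n, hn⟩ := Nat.exists_eq_succ_of_ne_zero (mt List.length_eq_zero_iff.1 hne)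
    have hlt : n < Θ.length := by omega
    simp only [Fin.val_last]
    rw [hn, hsucc n ⟨hlt, hΛ n hlt.le⟩]
    exact (hstep n hlt).2.2.2 hn.symm
  · have := (hstep i i.2).2.1
    rw [← hsucc i ⟨i.2, hΛ i i.2.le⟩] at this
    exact this
  · have := (hstep i (by omega)).2.2.1 hi
    rw [← hsucc i ⟨by omega, hΛ i (by omega)⟩] at this
    exact Set.subset_inter this.1 ((hΛ (i + 1) hi.le).vars_subset hi)
  · have := (hstep i (by omega)).2.2.1 hi
    rw [← hsucc i ⟨by omega, hΛ i (by omega)⟩] at this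
    refine Set.subset_inter ?_ this.2
    have h2 := (hΛ (i + 1) hi.le).fns_subset
    simpa only [Nat.lt_succ_iff] using h2

end Formulae

/-! ### Soundness of preconditions and the sequence `Ξ`. -/

section Loops

variable {Fn : List Ty → Ty → Type} {X : Ty → Type}

theorem holds_frame (I : Interp Fn) (ρ : Val (Sup (Fin 2) X)) (A : Finset (AllVar X)) :
    (frame Fn A).Holds I ρ ↔ ∀ y ∈ A, ρ y.1 (y.2, 1) = ρ y.1 (y.2, 0) := by
  rw [frame, FO.holds_conj, List.forall_mem_map]
  refine ⟨fun h y hy => ?_, fun h y hy => ?_⟩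
  · have := h y (Finset.mem_toList.2 hy)
    simpa only [FO.Holds, Tm.eval, decide_eq_true_eq] using of_decide_eq_true this
  · exact decide_eq_true (h y (Finset.mem_toList.1 hy))

theorem isEx_frame (A : Finset (AllVar X)) : (frame Fn A).IsEx := by
  refine FO.isEx_conj _ ?_
  rw [List.forall_mem_map]
  exact fun _ _ => trivial

theorem Xi_index (L : List (Stmt X)) {i : ℕ} (hi : i < L.length + 2) :
    i = 0 ∨ (∃ k, i = k + 1 ∧ k < L.length) ∨ i = L.length + 1 := by
  rcases i with _ | k
  · exact Or.inl rfl
  · rcases lt_or_ge k L.length with h | h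
    · exact Or.inr (Or.inl ⟨k, rfl, h⟩)
    · exact Or.inr (Or.inr (by omega))

variable [∀ s, Fintype (X s)]

/-- Quantifiers arise only from sequential composition, existentially, and negation is applied only
to quantifier-free guards. -/
theorem Stmt.isEx_trans (S : Stmt X) : (S.trans Fn).IsEx := by
  induction S with
  | nop => exact isEx_frame _
  | nondet => exact isEx_frame _
  | assign => exact ⟨trivial, isEx_frame _⟩
  | seq S T ih ih' => exact ⟨ih.subst _, ih'.subst _⟩
  | ite p S T ih ih' => exact ⟨⟨trivial, ih⟩, trivial, ih'⟩

/-- The precondition guarantees the postcondition after every transition. -/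
theorem Stmt.holds_of_pre (I : Interp Fn) (S : Stmt X) :
    ∀ (θ : FO Fn X) (ρ : Val (Sup (Fin 2) X)), (S.pre θ).Holds I (fun s x => ρ s (x, 0)) →
      (S.trans Fn).Holds I ρ → θ.Holds I (fun s x => ρ s (x, 1)) := by
  classical
  induction S with
  | nop =>
    intro θ ρ h hS
    simp only [Stmt.trans, holds_frame] at hS
    have : (fun s x => ρ s (x, 1) : Val X) = fun s x => ρ s (x, 0) :=
      funext fun s => funext fun x => hS ⟨s, x⟩ (Finset.mem_univ _)
    rw [this]
    exact h
  | nondet s x =>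
    intro θ ρ h hS
    simp only [Stmt.trans, holds_frame] at hS
    simp only [Stmt.pre, FO.Holds, FO.holds_rename] at h
    -- The universally quantified variable is instantiated with the value of `x` after the
    -- transition.
    have := h fun t e => e.down ▸ ρ s (x, 1)
    convert this using 1
    funext t y
    by_cases hy : (⟨t, y⟩ : AllVar X) = ⟨s, x⟩
    · rw [dif_pos hy]
      cases hy
      rfl
    · rw [dif_neg hy]
      exact hS ⟨t, y⟩ (Finset.mem_erase.2 ⟨hy, Finset.mem_univ _⟩)
  | assign x e =>
    intro θ ρ h hS
    obtain ⟨hx, hS⟩ := hS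
    rw [holds_frame] at hS
    have hx : ρ .num (x, 1) = (e.toTm Fn).eval I (fun s x => ρ s (x, 0)) := by
      have := of_decide_eq_true hx
      rwa [Tm.eval_rename] at this
    simp only [Stmt.pre, FO.holds_subst] at h
    convert h using 1
    funext t y
    cases t with
    | num =>
      by_cases hy : y = x
      · subst hy
        simpa only [if_true] using hx
      · simp only [if_neg hy]
        exact hS ⟨.num, y⟩ (Finset.mem_erase.2 ⟨by simpa using hy, Finset.mem_univ _⟩)
    | bool => exact hS ⟨.bool, y⟩ (Finset.mem_erase.2 ⟨by simp, Finset.mem_univ _⟩)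
  | seq S T ih ih' =>
    intro θ ρ h hST
    obtain ⟨μ, hS, hT⟩ := hST
    rw [FO.holds_rename] at hS hT
    have h1 := ih (T.pre θ) _ (by simpa [Stmt.pre] using h) hS
    have h2 := ih' θ _ (by simpa using h1) hT
    simpa using h2
  | ite p S T ih ih' =>
    intro θ ρ h hST
    obtain ⟨h1, h2⟩ := h
    rcases hST with ⟨hp, hS⟩ | ⟨hp, hT⟩
    · simp only [FO.Holds, Tm.eval_rename] at hp
      exact ih θ ρ (h1.resolve_left (not_not_intro hp)) hS
    · simp only [FO.Holds, Tm.eval, Tm.eval_rename, Bool.not_eq_true'] at hp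
      refine ih' θ ρ (h2.resolve_left (not_not_intro ?_)) hT
      simp [FO.Holds, hp]

theorem Stmt.holds_of_pre_seqs (I : Interp Fn) (L : List (Stmt X)) (θ : FO Fn X) :
    ∀ ρ : ℕ → Val X, ((Stmt.seqs L).pre θ).Holds I (ρ 0) →
      (∀ (k : ℕ) (hk : k < L.length),
        (L[k].trans Fn).Holds I (fun s v => ρ (k + v.2.val) s v.1)) →
      θ.Holds I (ρ L.length) := by
  induction L with
  | nil => exact fun ρ h _ => h
  | cons S L ih =>
    intro ρ h hL
    have hS := hL 0 (Nat.succ_pos _)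
    cases L with
    | nil => exact S.holds_of_pre I θ (fun s v => ρ (0 + v.2.val) s v.1) h hS
    | cons T L =>
      -- The run of the remaining statements starts one state later, in the state reached by `S`.
      refine ih (fun k => ρ (k + 1)) (S.holds_of_pre I _ (fun s v => ρ (0 + v.2.val) s v.1) h hS) fun k hk => ?_
      have := hL (k + 1) (Nat.succ_lt_succ hk)
      simpa only [List.getElem_cons_succ, Nat.add_right_comm] using this

theorem Xi_length (φ : QF Fn X) (L : List (Stmt X)) (ψ : QF Fn X) :
    (Xi φ L ψ).length = L.length + 2 := by
  simp [Xi]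

theorem Xi_getElem_zero (φ : QF Fn X) (L : List (Stmt X)) (ψ : QF Fn X) :
    (Xi φ L ψ)[0]'(by simp [Xi]) = .qf (φ.rename fun _ x => (x, 0)) := by
  simp [Xi]

theorem Xi_getElem_succ (φ : QF Fn X) (L : List (Stmt X)) (ψ : QF Fn X) (k : ℕ)
    (hk : k < L.length) : (Xi φ L ψ)[k + 1]'(by simp [Xi]; omega) =
      (L[k].trans Fn).rename fun _ v => (v.1, k + v.2.val) := by
  simp [Xi, hk]

theorem Xi_getElem_last (φ : QF Fn X) (L : List (Stmt X)) (ψ : QF Fn X) :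
    (Xi φ L ψ)[L.length + 1]'(by simp [Xi]) =
      .qf (.not (ψ.rename fun _ x => (x, L.length))) := by
  simp [Xi]

theorem Xi_isEx (φ : QF Fn X) (L : List (Stmt X)) (ψ : QF Fn X) :
    ∀ θ ∈ Xi φ L ψ, θ.IsEx := by
  intro θ hθ
  obtain ⟨i, hi, rfl⟩ := List.mem_iff_getElem.1 hθ
  rcases Xi_index L ((Xi_length φ L ψ) ▸ hi) with rfl | ⟨k, rfl, hk⟩ | rfl
  · rw [Xi_getElem_zero]; trivial
  · rw [Xi_getElem_succ _ _ _ _ hk]; exact (Stmt.isEx_trans _).subst _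
  · rw [Xi_getElem_last]; trivial

/-- Copy `k` occurs only as the target of entry `k` and the source of entry `k + 1`. Hence entries
that share a variable are equal or adjacent, which is the locality needed for iterated
interpolation. -/
theorem Xi_vars_index (φ : QF Fn X) (L : List (Stmt X)) (ψ : QF Fn X) (i : ℕ)
    (hi : i < (Xi φ L ψ).length) {v : AllVar (Sup ℕ X)} (hv : v ∈ (Xi φ L ψ)[i].vars) :
    v.2.2 ≤ i ∧ i ≤ v.2.2 + 1 := by
  rcases Xi_index L ((Xi_length φ L ψ) ▸ hi) with rfl | ⟨k, rfl, hk⟩ | rfl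
  · rw [Xi_getElem_zero] at hv
    obtain ⟨u, -, rfl⟩ := Tm.mem_vars_rename _ _ hv
    exact ⟨le_rfl, Nat.zero_le _⟩
  · rw [Xi_getElem_succ _ _ _ _ hk] at hv
    obtain ⟨u, -, rfl⟩ := FO.mem_vars_rename _ _ hv
    have := u.2.2.2
    dsimp only
    omega
  · rw [Xi_getElem_last] at hv
    obtain ⟨u, -, rfl⟩ := Tm.mem_vars_rename _ _ hv
    exact ⟨Nat.le_succ _, le_rfl⟩

theorem exists_interpolant_Xi {φ ψ : QF Fn X} {L : List (Stmt X)}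
    (h : FO.Entails (.qf φ) ((Stmt.seqs L).pre (.qf ψ))) :
    ∃ Λ, IsInductiveInterpolant (Xi φ L ψ) Λ := by
  have hlen := Xi_length φ L ψ
  refine exists_isInductiveInterpolant ?_ (Xi_isEx φ L ψ) ?_ ?_
  · exact List.ne_nil_of_length_pos (by omega)
  · rintro i j hij hj v ⟨hv, hv'⟩
    have h1 := Xi_vars_index φ L ψ i (hij.trans hj) hv
    have h2 := Xi_vars_index φ L ψ j hj hv'
    have : j = i + 1 := by omega
    subst this
    exact hv'
  · intro I ν hall
    have hall : ∀ (i : ℕ) (hi : i < (Xi φ L ψ).length), (Xi φ L ψ)[i].Holds I ν :=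
      fun i hi => hall _ (List.getElem_mem hi)
    have h0 := hall 0 (by omega)
    have hl := hall (L.length + 1) (by omega)
    rw [Xi_getElem_zero, FO.Holds, Tm.eval_rename] at h0
    rw [Xi_getElem_last] at hl
    simp only [FO.Holds, Tm.eval, Tm.eval_rename, Bool.not_eq_true'] at hl
    -- State `k` of the run is the restriction of the common model to copy `k` of the variables.
    have := Stmt.holds_of_pre_seqs I L (.qf ψ) (fun k s x => ν s (x, k)) (h I _ h0)
      fun k hk => by
        have := hall (k + 1) (by omega)
        rwa [Xi_getElem_succ _ _ _ _ hk, FO.holds_rename] at this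
    simp only [FO.Holds] at this
    rw [hl] at this
    cases this

end Loops

end LoopInterp

theorem mainTheorem3 {Fn : List LoopInterp.Ty → LoopInterp.Ty → Type}
    {X : LoopInterp.Ty → Type} [∀ s, Fintype (X s)]
    (L : LoopInterp.Loop X) (ι θ : LoopInterp.QF Fn X)
    (hι : L.IsUnderApprox ι)
    (hθ : LoopInterp.FO.Entails (.qf (.and ι (L.guard.toQF Fn)))
      ((LoopInterp.Stmt.seqs L.body).pre (.qf θ))) :
    ∃ Λ, LoopInterp.IsInductiveInterpolant
      (LoopInterp.Xi (.and ι (L.guard.toQF Fn)) L.body θ) Λ :=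
  LoopInterp.exists_interpolant_Xi hθ
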